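/- Let $k$ be a field, let $q\in k$ be nonzero, and let $1\le m\le n$ be integers. Let $\mathcal{O}_q(M_{mn})$ be the $k$-algebra generated by $X_{ij}$ ($1\le i\le m$, $1\le j\le n$) subject to the relations $$X_{ij}X_{il}=qX_{il}X_{ij}\quad(j<l),\qquad X_{ij}X_{i'j}=qX_{i'j}X_{ij}\quad(i<i'),$$ $$X_{il}X_{i'j}=X_{i'j}X_{il},\qquad X_{ij}X_{i'l}-X_{i'l}X_{ij}=(q-q^{-1})X_{il}X_{i'j}\quad(i<i',\ j<l).$$ For $J=\{j_1<\dots<j_m\}\subseteq\{1,\dots,n\}$ let $[J]=\sum_{\sigma\in S_m}(-q)^{\ell(\sigma)}X_{1,j_{\sigma(1)}}\cdots X_{m,j_{\sigma(m)}}$ be the corresponding maximal quantum minor, where $\ell(\sigma)$ is the number of inversions of $\sigma$, and let $\mathcal{G}_q(m,n)$ be the subalgebra of $\mathcal{O}_q(M_{mn})$ generated by all the $[J]$. It carries the $\mathbb{Z}^n$-grading induced from the grading of $\mathcal{O}_q(M_{mn})$ in which $X_{ij}$ has degree $\varepsilon_j$, the $j$-th standard basis vector. For $m$-element subsets $A=\{a_1<\dots<a_m\}$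 and $B=\{b_1<\dots<b_m\}$ of $\{1,\dots,n\}$, write $A\le_* B$ if $a_i\le b_i$ for all $i$. A preferred $m$-tableau is a finite (possibly empty) sequence $T=(J_1,\dots,J_s)$ of $m$-element subsets of $\{1,\dots,n\}$ with $J_1\le_* J_2\le_*\dots\le_* J_s$; put $[T]=[J_1][J_2]\cdots[J_s]$, with $[T]=1$ if $s=0$. The content of $T$ is the multiset $(1^{t_1}2^{t_2}\cdots n^{t_n})$, where $t_j$ is the number of indices $r$ with $j\in J_r$. (a) Let $\delta=(c_1,\dots,c_n)\in\mathbb{N}^n$, where $\mathbb N$ includes $0$, and let $V$ be the homogeneous component of $\mathcal{G}_q(m,n)$ of degree $\delta$. Then the products $[T]$, as $T$ runs over all preferred $m$-tableaux with content $(1^{c_1}2^{c_2}\cdots n^{c_n})$, form a $k$-basis of $V$. (b) The products $[T]$, as $T$ runs over all preferred $m$-tableaux, form a $k$-basis of $\mathcal{G}_q(m,n)$. -/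

import Mathlib

namespace QuantumGrassmannian

/-- The defining relations of the algebra of quantum `m × n` matrices, imposed on the free
algebra on letters `X_{ij}`; rows and columns are numbered from `0`. -/
inductive MatrixRel {k : Type*} [Field k] (q : k) (m n : ℕ) :
    FreeAlgebra k (Fin m × Fin n) → FreeAlgebra k (Fin m × Fin n) → Prop
  | row (i : Fin m) (j l : Fin n) (hjl : j < l) :
      MatrixRel q m n
        (FreeAlgebra.ι k (i, j) * FreeAlgebra.ι k (i, l))
        (q • (FreeAlgebra.ι k (i, l) * FreeAlgebra.ι k (i, j)))
  | col (i i' : Fin m) (j : Fin n) (hi : i < i') :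
      MatrixRel q m n
        (FreeAlgebra.ι k (i, j) * FreeAlgebra.ι k (i', j))
        (q • (FreeAlgebra.ι k (i', j) * FreeAlgebra.ι k (i, j)))
  | anti (i i' : Fin m) (j l : Fin n) (hi : i < i') (hjl : j < l) :
      MatrixRel q m n
        (FreeAlgebra.ι k (i, l) * FreeAlgebra.ι k (i', j))
        (FreeAlgebra.ι k (i', j) * FreeAlgebra.ι k (i, l))
  | diag (i i' : Fin m) (j l : Fin n) (hi : i < i') (hjl : j < l) :
      MatrixRel q m n
        (FreeAlgebra.ι k (i, j) * FreeAlgebra.ι k (i', l)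
          - FreeAlgebra.ι k (i', l) * FreeAlgebra.ι k (i, j))
        ((q - q⁻¹) • (FreeAlgebra.ι k (i, l) * FreeAlgebra.ι k (i', j)))

/-- The coordinate ring `O_q(M_{mn})` of quantum `m × n` matrices over `k`. -/
def QMatrix {k : Type*} [Field k] (q : k) (m n : ℕ) : Type _ :=
  RingQuot (MatrixRel q m n)

noncomputable instance {k : Type*} [Field k] (q : k) (m n : ℕ) : Ring (QMatrix q m n) :=
  inferInstanceAs (Ring (RingQuot (MatrixRel q m n)))

noncomputable instance {k : Type*} [Field k] (q : k) (m n : ℕ) : Algebra k (QMatrix q m n) :=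
  inferInstanceAs (Algebra k (RingQuot (MatrixRel q m n)))

/-- The quotient map from the free algebra onto `O_q(M_{mn})`. -/
noncomputable def QMatrix.mk {k : Type*} [Field k] (q : k) (m n : ℕ) :
    FreeAlgebra k (Fin m × Fin n) →ₐ[k] QMatrix q m n :=
  RingQuot.mkAlgHom k (MatrixRel q m n)

/-- The canonical generator `X_{ij}` of `O_q(M_{mn})`. -/
noncomputable def X {k : Type*} [Field k] (q : k) {m n : ℕ} (i : Fin m) (j : Fin n) :
    QMatrix q m n :=
  QMatrix.mk q m n (FreeAlgebra.ι k (i, j))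

/-- The length `ℓ(σ)` of a permutation, as its number of inversions. -/
def invCount {s : ℕ} (σ : Equiv.Perm (Fin s)) : ℕ :=
  (Finset.univ.filter fun p : Fin s × Fin s => p.1 < p.2 ∧ σ p.2 < σ p.1).card

/-- The quantum minor `[I | J]`.  An `s`-element index set is represented by its increasing
enumeration. -/
noncomputable def quantumMinor {k : Type*} [Field k] (q : k) {m n s : ℕ}
    (I : Fin s ↪o Fin m) (J : Fin s ↪o Fin n) : QMatrix q m n :=
  ∑ σ : Equiv.Perm (Fin s),
    (-q) ^ invCount σ • (List.ofFn fun a : Fin s => X q (I a) (J (σ a))).prod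

/-- The maximal quantum minor `[J]`, which uses all the rows and the columns in `J`. -/
noncomputable def maxMinor {k : Type*} [Field k] (q : k) {m n : ℕ}
    (J : Fin m ↪o Fin n) : QMatrix q m n :=
  quantumMinor q (RelEmbedding.refl (· ≤ ·)) J

/-- The quantum grassmannian `G_q(m,n)`: the subalgebra of `O_q(M_{mn})` generated by the
maximal quantum minors. -/
noncomputable def grassmannian {k : Type*} [Field k] (q : k) (m n : ℕ) :
    Subalgebra k (QMatrix q m n) :=
  Algebra.adjoin k (Set.range fun J : Fin m ↪o Fin n => maxMinor q J)

/-- The maximal quantum minor `[J]`, as an element of `G_q(m,n)`. -/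
noncomputable def gMinor {k : Type*} [Field k] (q : k) {m n : ℕ}
    (J : Fin m ↪o Fin n) : grassmannian q m n :=
  ⟨maxMinor q J, Algebra.subset_adjoin ⟨J, rfl⟩⟩

/-- The degree in `ℤ^n` of a word in the generators, where `X_{ij}` has degree `ε_j`. -/
def wordDegree {m n : ℕ} (w : List (Fin m × Fin n)) : Fin n → ℤ :=
  (w.map fun p => Pi.single p.2 1).sum

/-- The homogeneous component of degree `d` of `O_q(M_{mn})`: the span of the monomials in the
generators that have degree `d`. -/
noncomputable def matrixComponent {k : Type*} [Field k] (q : k) (m n : ℕ) (d : Fin n → ℤ) :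
    Submodule k (QMatrix q m n) :=
  Submodule.span k
    ((fun w : List (Fin m × Fin n) => (w.map fun p => X q p.1 p.2).prod) ''
      {w | wordDegree w = d})

/-- The homogeneous component of degree `d` of `G_q(m,n)` for the grading induced from
`O_q(M_{mn})`. -/
noncomputable def grassmannianComponent {k : Type*} [Field k] (q : k) (m n : ℕ)
    (d : Fin n → ℤ) : Submodule k (grassmannian q m n) :=
  (matrixComponent q m n d).comap (grassmannian q m n).val.toLinearMap

/-- An allowable `m`-tableau with entries in an `n`-element set: a finite list of strictly
increasing rows of length `m`. -/
abbrev Tableau (m n : ℕ) : Type := List (Fin m ↪o Fin n)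

/-- The order `≤_*` on `m`-element subsets: entrywise comparison of increasing enumerations. -/
def StarLE {m n : ℕ} (A B : Fin m ↪o Fin n) : Prop := ∀ a : Fin m, A a ≤ B a

/-- `T` is preferred if its rows satisfy `J_1 ≤_* J_2 ≤_* … ≤_* J_s`. -/
def Tableau.Preferred {m n : ℕ} (T : Tableau m n) : Prop := List.IsChain StarLE T

/-- The content of a tableau: the multiset of its entries. -/
def Tableau.content {m n : ℕ} (T : Tableau m n) : Multiset (Fin n) :=
  (T.map fun J : Fin m ↪o Fin n => (Finset.univ : Finset (Fin m)).val.map J).sum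

/-- The multiset `(1^{c_1} 2^{c_2} ⋯ n^{c_n})`. -/
def multisetOf {n : ℕ} (c : Fin n → ℕ) : Multiset (Fin n) :=
  ∑ j, Multiset.replicate (c j) j

/-- The product `[T] = [J_1][J_2]⋯[J_s]` in `G_q(m,n)` given by a tableau. -/
noncomputable def tableauProduct {k : Type*} [Field k] (q : k) {m n : ℕ}
    (T : Tableau m n) : grassmannian q m n :=
  (T.map fun J => gMinor q J).prod

end QuantumGrassmannian

/-!
Spanning. The minors of a list of rows are the coefficients of a product of vectors in the quantum
exterior algebra. Since minors can be expanded along rows as well as along columns, the Laplace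
expansion shows that distributing `m + 1` or more distinct columns over two maximal minors, with
signs and powers of `q`, gives zero. If `[A][B]` is not preferred, say `B i < A i`, this applies to
the columns `B 0 < ⋯ < B i < A i < ⋯` and rewrites `[A][B]` by products of the same content whose
first row has smaller sum, so straightening terminates.

Independence. The entries of a product of commuting quantum matrices again form a quantum matrix,
by the matrix form `R x₁ x₂ = x₂ x₁ R` of the relations. This yields a representation by operators
on a polynomial ring, which are weighted shifts up to terms of smaller weight. By the rearrangement
inequality `[J]` is then led by its diagonal term, and the leading exponent of `[T]`, for preferred
`T` of given length, records how often each entry occurs in each column of `T`, hence `T` itself.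

Grading. The coaction of the torus shows that the components are independent, so that products of
different lengths cannot be related.
-/

namespace QuantumGrassmannian

open Finset
open scoped Matrix

section QuantumMatrix

variable {k ι κ A : Type*} [Field k] [Ring A] [Algebra k A]

/-- The relations of quantum matrices, for a matrix with entries in an arbitrary algebra and
rows and columns indexed by arbitrary ordered types. -/
structure IsQuantumMatrix [Preorder ι] [Preorder κ] (q : k) (x : Matrix ι κ A) : Prop where
  row : ∀ i j l, j < l → x i j * x i l = q • (x i l * x i j)
  col : ∀ i i' j, i < i' → x i j * x i' j = q • (x i' j * x i j)
  anti : ∀ i i' j l, i < i' → j < l → x i l * x i' j = x i' j * x i l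
  diag : ∀ i i' j l, i < i' → j < l →
    x i j * x i' l - x i' l * x i j = (q - q⁻¹) • (x i l * x i' j)

theorem IsQuantumMatrix.transpose [Preorder ι] [Preorder κ] {q : k} {x : Matrix ι κ A}
    (h : IsQuantumMatrix q x) : IsQuantumMatrix q xᵀ where
  row i j l hjl := h.col j l i hjl
  col i i' j hi := h.row j i i' hi
  anti i i' j l hi hj := (h.anti j l i i' hj hi).symm
  diag i i' j l hi hj := by
    simp only [Matrix.transpose_apply]
    rw [h.diag j l i i' hj hi, h.anti j l i i' hj hi]

/-- The generic quantum matrix, whose entries are the generators of `O_q(M_{mn})`. -/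
noncomputable def generatorMatrix (q : k) (m n : ℕ) : Matrix (Fin m) (Fin n) (QMatrix q m n) :=
  Matrix.of fun i j => X q i j

@[simp] theorem generatorMatrix_apply (q : k) {m n : ℕ} (i : Fin m) (j : Fin n) :
    generatorMatrix q m n i j = X q i j := rfl

theorem isQuantumMatrix_generatorMatrix (q : k) (m n : ℕ) :
    IsQuantumMatrix q (generatorMatrix q m n) := by
  have mk_eq {a b} (h : MatrixRel q m n a b) : QMatrix.mk q m n a = QMatrix.mk q m n b :=
    RingQuot.mkAlgHom_rel k h
  constructor
  case row =>
    intro i j l hjl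
    simpa only [generatorMatrix_apply, X, map_mul, map_smul] using mk_eq (.row i j l hjl)
  case col =>
    intro i i' j hi
    simpa only [generatorMatrix_apply, X, map_mul, map_smul] using mk_eq (.col i i' j hi)
  case anti =>
    intro i i' j l hi hjl
    simpa only [generatorMatrix_apply, X, map_mul, map_smul] using mk_eq (.anti i i' j l hi hjl)
  case diag =>
    intro i i' j l hi hjl
    simpa only [generatorMatrix_apply, X, map_mul, map_smul, map_sub] using
      mk_eq (.diag i i' j l hi hjl)

theorem IsQuantumMatrix.exists_algHom {q : k} {m n : ℕ} {x : Matrix (Fin m) (Fin n) A}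
    (h : IsQuantumMatrix q x) :
    ∃ φ : QMatrix q m n →ₐ[k] A, ∀ i j, φ (X q i j) = x i j := by
  let f : FreeAlgebra k (Fin m × Fin n) →ₐ[k] A := FreeAlgebra.lift k fun p => x p.1 p.2
  have hf : ∀ ⦃a b⦄, MatrixRel q m n a b → f a = f b := by
    rintro _ _ (⟨i, j, l, hjl⟩ | ⟨i, i', j, hi⟩ | ⟨i, i', j, l, hi, hjl⟩ | ⟨i, i', j, l, hi, hjl⟩)
    · simpa [f] using h.row i j l hjl
    · simpa [f] using h.col i i' j hi
    · simpa [f] using h.anti i i' j l hi hjl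
    · simpa [f] using h.diag i i' j l hi hjl
  refine ⟨RingQuot.liftAlgHom k ⟨f, hf⟩, fun i j => ?_⟩
  exact (RingQuot.liftAlgHom_mkAlgHom_apply k f hf _).trans (FreeAlgebra.lift_ι_apply _ _)

end QuantumMatrix

section QuantumExteriorAlgebra

variable {κ : Type*} [LinearOrder κ]

/-- The number of elements of `T` below `j`. -/
def below (T : Finset κ) (j : κ) : ℕ := #{t ∈ T | t < j}

theorem below_erase_of_lt {T : Finset κ} {j l : κ} (h : j < l) :
    below (T.erase l) j = below T j := by
  rw [below, filter_erase, erase_eq_of_notMem (by simp [h.not_gt]), below]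

theorem below_erase_add_one {T : Finset κ} {j l : κ} (hj : j ∈ T) (h : j < l) :
    below (T.erase j) l + 1 = below T l := by
  rw [below, filter_erase, card_erase_add_one (by simp [hj, h]), below]

theorem below_insert_of_lt {T : Finset κ} {j l : κ} (hj : j ∉ T) (h : j < l) :
    below (insert j T) l = below T l + 1 := by
  rw [← below_erase_add_one (mem_insert_self j T) h, erase_insert hj]

theorem below_eq_zero {T : Finset κ} {j : κ} (h : ∀ t ∈ T, j ≤ t) : below T j = 0 := by
  rw [below, card_eq_zero, filter_eq_empty_iff]
  exact fun t ht => (h t ht).not_gt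

theorem below_union {P Q : Finset κ} (h : Disjoint P Q) (j : κ) :
    below (P ∪ Q) j = below P j + below Q j := by
  rw [below, filter_union, card_union_of_disjoint (disjoint_filter_filter h), below, below]

theorem below_map_univ {s : ℕ} (J : Fin s ↪o κ) (p : Fin s) :
    below (univ.map J.toEmbedding) (J p) = p := by
  have : (univ.filter ((fun t => t < J p) ∘ J.toEmbedding)) = Iio p := by ext a; simp
  rw [below, filter_map, card_map, this, Fin.card_Iio]

variable {k ι A : Type*} [Field k] [Ring A] [Algebra k A]

/-- Left multiplication by the vector `∑ j, v j ξ j` on the quantum exterior algebra over `A`,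
where `ξ j ξ j = 0` and `ξ l ξ j = -q ξ j ξ l` for `j < l`, in coordinates with respect to the
basis of increasing products of the `ξ j`. -/
def wedge (q : k) (v : κ → A) : (Finset κ → A) →ₗ[k] (Finset κ → A) where
  toFun g T := ∑ j ∈ T, (-q) ^ below T j • (v j * g (T.erase j))
  map_add' g g' := by
    ext T
    simp [mul_add, sum_add_distrib]
  map_smul' c g := by
    ext T
    simp [smul_sum, smul_comm c]

theorem wedge_apply (q : k) (v : κ → A) (g : Finset κ → A) (T : Finset κ) :
    wedge q v g T = ∑ j ∈ T, (-q) ^ below T j • (v j * g (T.erase j)) := rfl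

theorem wedge_wedge (q : k) (v w : κ → A) (g : Finset κ → A) (T : Finset κ) :
    wedge q v (wedge q w g) T = ∑ j ∈ T, ∑ l ∈ T, if j < l then
      (-q) ^ (below T j + below (T.erase j) l) •
        ((v j * w l - q • (v l * w j)) * g ((T.erase j).erase l)) else 0 := by
  let c (j l : κ) : A :=
    (-q) ^ (below T j + below (T.erase j) l) • (v j * w l * g ((T.erase j).erase l))
  have expand : wedge q v (wedge q w g) T =
      ∑ j ∈ T, ((∑ l ∈ T, if j < l then c j l else 0) + ∑ l ∈ T, if l < j then c j l else 0) := by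
    rw [wedge_apply]
    refine sum_congr rfl fun j hj => ?_
    rw [wedge_apply, mul_sum, smul_sum, ← sum_add_distrib, ← sum_erase_add T _ hj]
    simp only [lt_irrefl, if_false, add_zero]
    refine sum_congr rfl fun l hl => ?_
    have term_eq : (-q) ^ below T j • (v j * (-q) ^ below (T.erase j) l •
        (w l * g ((T.erase j).erase l))) = c j l := by
      simp only [c, pow_add, mul_smul, mul_smul_comm, mul_assoc]
    rcases lt_or_gt_of_ne (mem_erase.1 hl).1 with h | h
    · rw [if_neg h.not_gt, if_pos h, zero_add, term_eq]
    · rw [if_pos h, if_neg h.not_gt, add_zero, term_eq]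
  rw [expand, sum_add_distrib,
    sum_comm (s := T) (t := T) (f := fun j l => if l < j then c j l else 0), ← sum_add_distrib]
  refine sum_congr rfl fun j hj => ?_
  rw [← sum_add_distrib]
  refine sum_congr rfl fun l _ => ?_
  split_ifs with h
  · have below_swap : below T l + below (T.erase l) j = below T j + below (T.erase j) l + 1 := by
      rw [below_erase_of_lt h, ← below_erase_add_one hj h]
      ring
    simp only [c, below_swap, erase_right_comm (a := l), pow_succ, sub_mul, smul_sub,
      smul_mul_assoc, mul_smul, neg_smul, smul_neg]
    rw [← sub_eq_add_neg]
  · exact add_zero 0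

variable [LinearOrder ι] {q : k} {x : Matrix ι κ A}

theorem IsQuantumMatrix.wedge_wedge_self (h : IsQuantumMatrix q x) (i : ι)
    (g : Finset κ → A) : wedge q (x i) (wedge q (x i) g) = 0 := by
  ext T
  rw [wedge_wedge]
  refine sum_eq_zero fun j _ => sum_eq_zero fun l _ => ?_
  split_ifs with hjl
  · rw [h.row i j l hjl, sub_self, zero_mul, smul_zero]
  · rfl

theorem IsQuantumMatrix.wedge_wedge_of_lt (hq : q ≠ 0) (h : IsQuantumMatrix q x) {i i' : ι}
    (hi : i < i') (g : Finset κ → A) :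
    wedge q (x i') (wedge q (x i) g) = -q • wedge q (x i) (wedge q (x i') g) := by
  ext T
  rw [Pi.smul_apply, wedge_wedge, wedge_wedge, smul_sum]
  refine sum_congr rfl fun j _ => ?_
  rw [smul_sum]
  refine sum_congr rfl fun l _ => ?_
  split_ifs with hjl
  · rw [smul_comm (-q), ← smul_mul_assoc (-q)]
    congr 2
    rw [sub_eq_iff_eq_add.1 (h.diag i i' j l hi hjl), ← h.anti i i' j l hi hjl]
    simp only [smul_sub, smul_add, smul_smul, neg_mul, neg_smul, mul_inv_cancel₀ hq, sub_smul,
      one_smul]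
    abel
  · rw [smul_zero]

theorem IsQuantumMatrix.exists_wedge_wedge_comm (hq : q ≠ 0) (h : IsQuantumMatrix q x)
    (i i' : ι) : ∃ s : k, s ≠ 0 ∧ ∀ g : Finset κ → A,
      wedge q (x i) (wedge q (x i') g) = s • wedge q (x i') (wedge q (x i) g) := by
  rcases lt_trichotomy i i' with hi | rfl | hi
  · refine ⟨-q⁻¹, neg_ne_zero.2 (inv_ne_zero hq), fun g => ?_⟩
    rw [h.wedge_wedge_of_lt hq hi, smul_smul, neg_mul_neg, inv_mul_cancel₀ hq, one_smul]
  · exact ⟨1, one_ne_zero, fun g => (one_smul k _).symm⟩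
  · exact ⟨-q, neg_ne_zero.2 hq, h.wedge_wedge_of_lt hq hi⟩

end QuantumExteriorAlgebra

section ListMinor

variable {k ι κ A : Type*} [Field k] [Ring A] [Algebra k A] [LinearOrder κ] {q : k}
  {x : Matrix ι κ A}

/-- The quantum minor of `x` with a list of rows `l` and a set of columns `T`: the coefficient
of the increasing product of the `ξ j`, `j ∈ T`, in the product over `i ∈ l` of the vectors
`∑ j, x i j ξ j` of the quantum exterior algebra. -/
def listMinor (q : k) (x : Matrix ι κ A) : List ι → Finset κ → A
  | [] => Pi.single ∅ 1
  | i :: l => wedge q (x i) (listMinor q x l)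

theorem listMinor_cons_apply (i : ι) (l : List ι) (T : Finset κ) :
    listMinor q x (i :: l) T =
      ∑ j ∈ T, (-q) ^ below T j • (x i j * listMinor q x l (T.erase j)) := rfl

theorem listMinor_of_card_ne {l : List ι} {T : Finset κ} (h : #T ≠ l.length) :
    listMinor q x l T = 0 := by
  induction l generalizing T with
  | nil => exact Pi.single_eq_of_ne (by rintro rfl; simp at h) _
  | cons i l ih =>
    refine sum_eq_zero fun j hj => ?_
    have hcard : #(T.erase j) ≠ l.length := fun hl =>
      h (by rw [List.length_cons, ← hl, card_erase_add_one hj])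
    rw [ih hcard, mul_zero, smul_zero]

/-- The number of inversions between `P` and `Q`. -/
def crossings (P Q : Finset κ) : ℕ := ∑ p ∈ P, below Q p

theorem listMinor_append (l l' : List ι) (K : Finset κ) :
    listMinor q x (l ++ l') K = ∑ P ∈ K.powerset,
      (-q) ^ crossings P (K \ P) • (listMinor q x l P * listMinor q x l' (K \ P)) := by
  induction l generalizing K with
  | nil =>
    rw [sum_eq_single ∅]
    · simp [listMinor, crossings]
    · intro P _ hP
      rw [listMinor, Pi.single_eq_of_ne hP, zero_mul, smul_zero]
    · simp
  | cons i l ih =>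
    simp only [List.cons_append, listMinor_cons_apply, ih, mul_sum, smul_sum, sum_mul]
    rw [sum_sigma', sum_sigma']
    refine sum_bij' (fun a _ => ⟨insert a.1 a.2, a.1⟩) (fun a _ => ⟨a.2, a.1.erase a.2⟩)
      ?_ ?_ ?_ ?_ ?_
    all_goals
      rintro ⟨_, _⟩ h
      simp only [mem_sigma, mem_powerset] at h
    · simpa using insert_subset h.1 (h.2.trans (erase_subset _ _))
    · simpa using ⟨h.1 h.2, erase_subset_erase _ h.1⟩
    · simp [notMem_mono h.2 (notMem_erase _ _)]
    · simp [h.2]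
    · rename_i j P
      have hj : j ∉ P := notMem_mono h.2 (notMem_erase _ _)
      have hK : K.erase j \ P = K \ insert j P := by rw [erase_sdiff_comm, sdiff_insert]
      have hbelow : below K j = below (insert j P) j + below (K \ insert j P) j := by
        rw [← below_union disjoint_sdiff, union_sdiff_of_subset]
        exact insert_subset h.1 (h.2.trans (erase_subset _ _))
      simp only [erase_insert hj, hK, crossings, sum_insert hj, hbelow, mul_smul_comm,
        smul_mul_assoc, smul_smul, ← pow_add, mul_assoc]
      congr 2
      ring

theorem listMinor_cons_insert_of_lt (i : ι) (l : List ι) {J : Finset κ} {j : κ}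
    (hj : ∀ t ∈ J, j < t) :
    listMinor q x (i :: l) (insert j J) = x i j * listMinor q x l J +
      ∑ t ∈ J, (-q) ^ (below J t + 1) •
        (x i t * listMinor q x l (insert j (J.erase t))) := by
  have hjJ : j ∉ J := fun h => lt_irrefl j (hj j h)
  have hmin : below (insert j J) j = 0 := below_eq_zero fun t ht =>
    (mem_insert.1 ht).elim (fun h => h.ge) fun h => (hj t h).le
  rw [listMinor_cons_apply, sum_insert hjJ, hmin, pow_zero, one_smul, erase_insert hjJ]
  congr 1
  refine sum_congr rfl fun t ht => ?_
  rw [below_insert_of_lt hjJ (hj t ht), erase_insert_of_ne (hj t ht).ne]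

variable [LinearOrder ι]

theorem IsQuantumMatrix.exists_listMinor_perm (hq : q ≠ 0) (h : IsQuantumMatrix q x)
    {l l' : List ι} (hl : l.Perm l') :
    ∃ s : k, s ≠ 0 ∧ listMinor q x l = s • listMinor q x l' := by
  induction hl with
  | nil => exact ⟨1, one_ne_zero, (one_smul k _).symm⟩
  | cons i _ ih =>
    obtain ⟨s, hs, ih⟩ := ih
    exact ⟨s, hs, by rw [listMinor, listMinor, ih, map_smul]⟩
  | swap i i' l =>
    obtain ⟨s, hs, hcomm⟩ := h.exists_wedge_wedge_comm hq i' i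
    exact ⟨s, hs, hcomm _⟩
  | trans _ _ ih ih' =>
    obtain ⟨s, hs, ih⟩ := ih
    obtain ⟨s', hs', ih'⟩ := ih'
    exact ⟨s * s', mul_ne_zero hs hs', by rw [ih, ih', smul_smul]⟩

theorem IsQuantumMatrix.wedge_listMinor_of_mem (hq : q ≠ 0) (h : IsQuantumMatrix q x)
    {i : ι} {l : List ι} (hi : i ∈ l) : wedge q (x i) (listMinor q x l) = 0 := by
  obtain ⟨l', hl⟩ : ∃ l', l.Perm (i :: l') := ⟨_, List.perm_cons_erase hi⟩
  obtain ⟨s, -, hs⟩ := h.exists_listMinor_perm hq hl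
  rw [hs, map_smul, listMinor, h.wedge_wedge_self, smul_zero]

theorem IsQuantumMatrix.listMinor_of_not_nodup (hq : q ≠ 0) (h : IsQuantumMatrix q x)
    {l : List ι} (hl : ¬ l.Nodup) : listMinor q x l = 0 := by
  induction l with
  | nil => exact absurd List.nodup_nil hl
  | cons i l ih =>
    rw [listMinor]
    by_cases hi : i ∈ l
    · exact h.wedge_listMinor_of_mem hq hi
    · rw [ih fun hn => hl (List.nodup_cons.2 ⟨hi, hn⟩), map_zero]

theorem sort_insert_of_lt {I : Finset ι} {i : ι} (h : ∀ a ∈ I, i < a) :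
    (insert i I).sort (· ≤ ·) = i :: I.sort (· ≤ ·) :=
  sort_insert (r := (· ≤ ·)) (fun a ha => (h a ha).le) fun hi => lt_irrefl _ (h i hi)

theorem exists_insert_min {I : Finset ι} (hI : I.Nonempty) :
    ∃ (i : ι) (I' : Finset ι), (∀ a ∈ I', i < a) ∧ i ∉ I' ∧ insert i I' = I :=
  ⟨I.min' hI, I.erase (I.min' hI), fun _ => min'_lt_of_mem_erase_min' _ _, notMem_erase _ _,
    insert_erase (min'_mem _ _)⟩

/-- Expanding along the first row and then the first column gives the same double sum as
expanding along the first column and then the first row, since `x i t` and `x a j` commute for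
`i < a` and `j < t`. -/
theorem IsQuantumMatrix.listMinor_sort_insert_transpose (h : IsQuantumMatrix q x)
    {I : Finset ι} {J : Finset κ} {i : ι} {j : κ} (hi : ∀ a ∈ I, i < a) (hj : ∀ t ∈ J, j < t)
    (ih : ∀ (I' : Finset ι) (J' : Finset κ), #I' ≤ #I →
      listMinor q x (I'.sort (· ≤ ·)) J' = listMinor q xᵀ (J'.sort (· ≤ ·)) I') :
    listMinor q x ((insert i I).sort (· ≤ ·)) (insert j J) =
      listMinor q xᵀ ((insert j J).sort (· ≤ ·)) (insert i I) := by
  have expand_row : ∀ t ∈ J, x i t * listMinor q x (I.sort (· ≤ ·)) (insert j (J.erase t)) =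
      ∑ a ∈ I, (-q) ^ below I a •
        (x i t * x a j * listMinor q x ((I.erase a).sort (· ≤ ·)) (J.erase t)) := by
    intro t _
    rw [ih _ _ le_rfl, sort_insert_of_lt fun b hb => hj b (mem_of_mem_erase hb),
      listMinor_cons_apply, mul_sum]
    refine sum_congr rfl fun a _ => ?_
    rw [ih _ _ (card_le_card (erase_subset _ _)), mul_smul_comm, mul_assoc, Matrix.transpose_apply]
  have expand_col : ∀ a ∈ I, xᵀ j a * listMinor q xᵀ (J.sort (· ≤ ·)) (insert i (I.erase a)) =
      ∑ t ∈ J, (-q) ^ below J t •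
        (x i t * x a j * listMinor q x ((I.erase a).sort (· ≤ ·)) (J.erase t)) := by
    intro a ha
    have hcard : #(insert i (I.erase a)) ≤ #I :=
      (card_insert_le _ _).trans (card_erase_add_one ha).le
    rw [← ih _ _ hcard, sort_insert_of_lt fun b hb => hi b (mem_of_mem_erase hb),
      listMinor_cons_apply, mul_sum]
    refine sum_congr rfl fun t ht => ?_
    rw [Matrix.transpose_apply, h.anti i a j t (hi a ha) (hj t ht), mul_smul_comm, mul_assoc]
  rw [sort_insert_of_lt hi, sort_insert_of_lt hj, listMinor_cons_insert_of_lt _ _ hj,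
    listMinor_cons_insert_of_lt _ _ hi, Matrix.transpose_apply, ih I J le_rfl,
    sum_congr rfl fun t ht => congrArg _ (expand_row t ht),
    sum_congr rfl fun a ha => congrArg _ (expand_col a ha)]
  simp only [smul_sum, smul_smul]
  rw [sum_comm]
  refine congrArg _ (sum_congr rfl fun a _ => sum_congr rfl fun t _ => congrArg (· • _) ?_)
  ring

theorem IsQuantumMatrix.listMinor_sort_transpose (h : IsQuantumMatrix q x) (I : Finset ι)
    (J : Finset κ) : listMinor q x (I.sort (· ≤ ·)) J = listMinor q xᵀ (J.sort (· ≤ ·)) I := by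
  induction hN : #I using Nat.strong_induction_on generalizing I J with
  | _ N ih =>
  by_cases hcard : #I = #J
  · rcases I.eq_empty_or_nonempty with rfl | hI
    · obtain rfl : J = ∅ := card_eq_zero.1 (by rw [← hcard, card_empty])
      simp [listMinor]
    · obtain ⟨i, I, hi, hiI, rfl⟩ := exists_insert_min hI
      obtain ⟨j, J, hj, -, rfl⟩ := exists_insert_min (card_pos.1 (hcard ▸ card_pos.2 hI))
      refine h.listMinor_sort_insert_transpose hi hj fun I' J' hI' => ih #I' ?_ I' J' rfl
      rw [← hN, card_insert_of_notMem hiI]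
      exact Nat.lt_succ_of_le hI'
  · rw [listMinor_of_card_ne (by rwa [length_sort, ne_comm]),
      listMinor_of_card_ne (by rwa [length_sort])]

theorem IsQuantumMatrix.sum_listMinor_sort_mul_listMinor_sort (hq : q ≠ 0)
    (h : IsQuantumMatrix q x) {K : Finset κ} {I I' : Finset ι} (hK : #(I ∪ I') < #K) :
    ∑ P ∈ K.powerset, (-q) ^ crossings P (K \ P) •
      (listMinor q x (I.sort (· ≤ ·)) P * listMinor q x (I'.sort (· ≤ ·)) (K \ P)) = 0 := by
  rw [← listMinor_append]
  by_cases hn : (I.sort (· ≤ ·) ++ I'.sort (· ≤ ·)).Nodup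
  · refine listMinor_of_card_ne (ne_of_gt ?_)
    rwa [← List.toFinset_card_of_nodup hn, List.toFinset_append, sort_toFinset, sort_toFinset]
  · rw [h.listMinor_of_not_nodup hq hn, Pi.zero_apply]

/-- The quantum exchange relation. Expanding both factors by Laplace, the part of the sum that
depends on `P` is itself the Laplace expansion of a minor with more than `#(J ∪ J')` columns. -/
theorem IsQuantumMatrix.sum_listMinor_mul_listMinor (hq : q ≠ 0) (h : IsQuantumMatrix q x)
    {K : Finset ι} {J J' : Finset κ} (hK : #(J ∪ J') < #K) (l l' : List ι) :
    ∑ P ∈ K.powerset, (-q) ^ crossings P (K \ P) •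
      (listMinor q x (l ++ P.sort (· ≤ ·)) J *
        listMinor q x ((K \ P).sort (· ≤ ·) ++ l') J') = 0 := by
  have expand : ∀ P ∈ K.powerset, (-q) ^ crossings P (K \ P) •
      (listMinor q x (l ++ P.sort (· ≤ ·)) J *
        listMinor q x ((K \ P).sort (· ≤ ·) ++ l') J') =
      ∑ S ∈ J.powerset, ∑ S' ∈ J'.powerset,
        ((-q) ^ crossings S (J \ S) * (-q) ^ crossings S' (J' \ S')) •
        (listMinor q x l S *
          ((-q) ^ crossings P (K \ P) • (listMinor q xᵀ ((J \ S).sort (· ≤ ·)) P *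
            listMinor q xᵀ (S'.sort (· ≤ ·)) (K \ P))) *
          listMinor q x l' (J' \ S')) := by
    intro P _
    rw [listMinor_append, listMinor_append, sum_mul_sum, smul_sum]
    refine sum_congr rfl fun S _ => ?_
    rw [smul_sum]
    refine sum_congr rfl fun S' _ => ?_
    rw [h.listMinor_sort_transpose, h.listMinor_sort_transpose]
    simp only [smul_mul_assoc, mul_smul_comm, smul_smul, mul_assoc]
    congr 1
    ring
  rw [sum_congr rfl expand, sum_comm]
  refine sum_eq_zero fun S _ => ?_
  rw [sum_comm]
  refine sum_eq_zero fun S' hS' => ?_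
  have hcard : #(J \ S ∪ S') < #K :=
    (card_le_card (union_subset_union sdiff_subset (mem_powerset.1 hS'))).trans_lt hK
  rw [← smul_sum, ← sum_mul, ← mul_sum, h.transpose.sum_listMinor_sort_mul_listMinor_sort hq hcard,
    mul_zero, zero_mul, smul_zero]

end ListMinor

section MaxMinor

/-- The permutation of `Fin (s + 1)` with `0 ↦ p` that acts as `τ` on the remaining points. -/
def consPerm {s : ℕ} (p : Fin (s + 1)) (τ : Equiv.Perm (Fin s)) : Equiv.Perm (Fin (s + 1)) :=
  (finSuccEquiv s).trans (τ.optionCongr.trans (finSuccEquiv' p).symm)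

@[simp] theorem consPerm_zero {s : ℕ} (p : Fin (s + 1)) (τ : Equiv.Perm (Fin s)) :
    consPerm p τ 0 = p := by
  simp [consPerm]

@[simp] theorem consPerm_succ {s : ℕ} (p : Fin (s + 1)) (τ : Equiv.Perm (Fin s)) (a : Fin s) :
    consPerm p τ a.succ = p.succAbove (τ a) := by
  simp [consPerm]

theorem consPerm_bijective (s : ℕ) :
    Function.Bijective fun a : Fin (s + 1) × Equiv.Perm (Fin s) => consPerm a.1 a.2 := by
  rw [Fintype.bijective_iff_injective_and_card]
  constructor
  · rintro ⟨p, τ⟩ ⟨p', τ'⟩ h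
    obtain rfl : p = p' := by simpa using DFunLike.congr_fun h 0
    refine Prod.ext rfl (Equiv.ext fun a => ?_)
    simpa using DFunLike.congr_fun h a.succ
  · simp [Fintype.card_perm, Nat.factorial_succ]

theorem invCount_consPerm {s : ℕ} (p : Fin (s + 1)) (τ : Equiv.Perm (Fin s)) :
    invCount (consPerm p τ) = p + invCount τ := by
  have card_castSucc_lt : #{c : Fin s | c.castSucc < p} = p := by
    simp only [Fin.lt_def, Fin.val_castSucc, Fin.card_filter_val_lt]
    omega
  unfold invCount
  simp only [card_filter, Fintype.sum_prod_type, Fin.sum_univ_succ, consPerm_zero, consPerm_succ,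
    Fin.succ_pos, Fin.not_lt_zero, Fin.succ_lt_succ_iff, false_and, true_and, if_false,
    zero_add, Fin.succAbove_lt_succAbove_iff, Fin.succAbove_lt_iff_castSucc_lt]
  congr 1
  rw [Equiv.sum_comp τ (fun c => if c.castSucc < p then 1 else 0), ← card_filter,
    card_castSucc_lt]

theorem erase_map_univ {κ : Type*} [DecidableEq κ] [LE κ] {s : ℕ} (J : Fin (s + 1) ↪o κ)
    (p : Fin (s + 1)) :
    (univ.map J.toEmbedding).erase (J p) =
      univ.map ((Fin.succAboveOrderEmb p).trans J).toEmbedding := by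
  have hmap : (univ : Finset (Fin s)).map p.succAboveEmb = univ.erase p := by
    rw [← compl_singleton, ← Fin.image_succAbove_univ, map_eq_image]
    rfl
  rw [← RelEmbedding.coe_toEmbedding, ← map_erase, ← hmap, map_map]
  rfl

theorem sort_map_univ {κ : Type*} [LinearOrder κ] {s : ℕ} (J : Fin s ↪o κ) :
    (univ.map J.toEmbedding).sort (· ≤ ·) = List.ofFn J := by
  rw [List.ofFn_eq_map, ← Fin.sort_univ]
  exact (J.strictMono.strictMonoOn _).map_finsetSort.symm

variable {k : Type*} [Field k] {q : k}

theorem listMinor_ofFn {ι κ A : Type*} [LinearOrder κ] [Ring A] [Algebra k A]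
    (x : Matrix ι κ A) {s : ℕ} (I : Fin s → ι) (J : Fin s ↪o κ) :
    listMinor q x (List.ofFn I) (univ.map J.toEmbedding) =
      ∑ σ : Equiv.Perm (Fin s),
        (-q) ^ invCount σ • (List.ofFn fun a : Fin s => x (I a) (J (σ a))).prod := by
  induction s with
  | zero => simp [listMinor, invCount]
  | succ s ih =>
    rw [List.ofFn_succ, listMinor_cons_apply, sum_map, ← (consPerm_bijective s).sum_comp,
      Fintype.sum_prod_type]
    refine sum_congr rfl fun p _ => ?_
    rw [RelEmbedding.coe_toEmbedding, erase_map_univ, ih, mul_sum, smul_sum, below_map_univ]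
    refine sum_congr rfl fun τ _ => ?_
    rw [invCount_consPerm, List.ofFn_succ, List.prod_cons, mul_smul_comm, smul_smul, ← pow_add,
      consPerm_zero]
    simp only [consPerm_succ]
    rfl

variable {m n : ℕ}

theorem listMinor_transpose_ofFn (J : Fin m ↪o Fin n) :
    listMinor q (generatorMatrix q m n)ᵀ (List.ofFn J) univ = maxMinor q J := by
  rw [← sort_map_univ, ← (isQuantumMatrix_generatorMatrix q m n).listMinor_sort_transpose,
    Fin.sort_univ, ← List.ofFn_id, listMinor_ofFn]
  rfl

theorem exists_listMinor_transpose_eq_smul_maxMinor (hq : q ≠ 0) (J : Fin m ↪o Fin n)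
    {l : List (Fin n)} (hl : l.Perm (List.ofFn J)) :
    ∃ s : k, s ≠ 0 ∧ listMinor q (generatorMatrix q m n)ᵀ l univ = s • maxMinor q J := by
  obtain ⟨s, hs, h⟩ :=
    (isQuantumMatrix_generatorMatrix q m n).transpose.exists_listMinor_perm hq hl
  exact ⟨s, hs, by rw [h, Pi.smul_apply, listMinor_transpose_ofFn]⟩

theorem listMinor_transpose_eq_zero_or_eq_smul_maxMinor (hq : q ≠ 0) (l : List (Fin n)) :
    listMinor q (generatorMatrix q m n)ᵀ l univ = 0 ∨
      ∃ (J : Fin m ↪o Fin n) (s : k), l.Perm (List.ofFn J) ∧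
        listMinor q (generatorMatrix q m n)ᵀ l univ = s • maxMinor q J := by
  by_cases hn : l.Nodup
  · by_cases hm : l.length = m
    · have hcard : #l.toFinset = m := by rw [List.toFinset_card_of_nodup hn, hm]
      have hl : l.Perm (List.ofFn (l.toFinset.orderEmbOfFin hcard)) := by
        rw [← sort_map_univ, map_orderEmbOfFin_univ]
        exact ((sort_perm_toList _ _).trans (List.toFinset_toList hn)).symm
      obtain ⟨s, -, hs⟩ := exists_listMinor_transpose_eq_smul_maxMinor hq _ hl
      exact .inr ⟨_, s, hl, hs⟩
    · exact .inl (listMinor_of_card_ne (by simpa [eq_comm] using hm))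
  · left
    rw [(isQuantumMatrix_generatorMatrix q m n).transpose.listMinor_of_not_nodup hq hn,
      Pi.zero_apply]

end MaxMinor

section Straightening

variable {k : Type*} [Field k] {q : k} {m n : ℕ}

/-- The exchange relation, solved for the term in which `P` and `Q` stay in place. -/
theorem maxMinor_mul_maxMinor_mem_span_of_perm (hq : q ≠ 0) {A B : Fin m ↪o Fin n}
    {l l' : List (Fin n)} {P Q : Finset (Fin n)} (hPQ : Disjoint P Q) (hcard : m < #(P ∪ Q))
    (hA : (l ++ P.sort (· ≤ ·)).Perm (List.ofFn A))
    (hB : (l' ++ Q.sort (· ≤ ·)).Perm (List.ofFn B)) :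
    maxMinor q A * maxMinor q B ∈ Submodule.span k
      {y | ∃ (A' B' : Fin m ↪o Fin n) (R : Finset (Fin n)), R ⊆ P ∪ Q ∧ R ≠ P ∧
        (l ++ R.sort (· ≤ ·)).Perm (List.ofFn A') ∧
        (l' ++ ((P ∪ Q) \ R).sort (· ≤ ·)).Perm (List.ofFn B') ∧
        y = maxMinor q A' * maxMinor q B'} := by
  obtain ⟨s, hs, hsA⟩ := exists_listMinor_transpose_eq_smul_maxMinor hq A hA
  obtain ⟨t, ht, htB⟩ :=
    exists_listMinor_transpose_eq_smul_maxMinor hq B (List.perm_append_comm.trans hB)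
  have exchange := (isQuantumMatrix_generatorMatrix q m n).transpose.sum_listMinor_mul_listMinor
    hq (K := P ∪ Q) (J := univ) (J' := univ) (by simpa using hcard) l l'
  rw [← add_sum_erase _ _ (mem_powerset.2 subset_union_left), union_sdiff_cancel_left hPQ,
    hsA, htB, smul_mul_smul_comm, smul_smul] at exchange
  have hne : (-q) ^ crossings P Q * (s * t) ≠ 0 :=
    mul_ne_zero (pow_ne_zero _ (neg_ne_zero.2 hq)) (mul_ne_zero hs ht)
  rw [← Submodule.smul_mem_iff _ hne, eq_neg_of_add_eq_zero_left exchange]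
  refine Submodule.neg_mem _ (Submodule.sum_mem _ fun R hR => Submodule.smul_mem _ _ ?_)
  rw [mem_erase, mem_powerset] at hR
  rcases listMinor_transpose_eq_zero_or_eq_smul_maxMinor (m := m) hq (l ++ R.sort (· ≤ ·))
    with h0 | ⟨A', s', hA', hsA'⟩
  · rw [h0, zero_mul]
    exact Submodule.zero_mem _
  rcases listMinor_transpose_eq_zero_or_eq_smul_maxMinor (m := m) hq
    (((P ∪ Q) \ R).sort (· ≤ ·) ++ l') with h0 | ⟨B', t', hB', htB'⟩
  · rw [h0, mul_zero]
    exact Submodule.zero_mem _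
  rw [hsA', htB', smul_mul_smul_comm]
  exact Submodule.smul_mem _ _ (Submodule.subset_span
    ⟨A', B', R, hR.2, hR.1, hA', List.perm_append_comm.trans hB', rfl⟩)

/-- The sum of the entries of a row. -/
def rowSum (J : Fin m ↪o Fin n) : ℕ := ∑ a, (J a : ℕ)

theorem rowSum_eq_of_perm {J : Fin m ↪o Fin n} {l : List (Fin n)} {P : Finset (Fin n)}
    (h : (l ++ P.sort (· ≤ ·)).Perm (List.ofFn J)) :
    rowSum J = (l.map Fin.val).sum + ∑ t ∈ P, (t : ℕ) := by
  have hJ : ((List.ofFn J).map Fin.val).sum = rowSum J := by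
    rw [List.map_ofFn, List.sum_ofFn]
    rfl
  rw [← hJ, ← (h.map Fin.val).sum_eq, List.map_append, List.sum_append,
    ((sort_perm_toList P (· ≤ ·)).map Fin.val).sum_eq, sum_map_toList]

theorem sum_lt_sum_of_card_eq {P R : Finset (Fin n)} {a b : Fin n} (hba : b < a)
    (hcard : #R = #P) (hne : R ≠ P) (hR : ∀ t ∈ R \ P, t ≤ b) (hP : ∀ t ∈ P, a ≤ t) :
    ∑ t ∈ R, (t : ℕ) < ∑ t ∈ P, (t : ℕ) := by
  rw [← sum_sdiff_lt_sum_sdiff]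
  have hcard_sdiff : #(R \ P) = #(P \ R) := card_sdiff_comm hcard
  have hpos : 0 < #(P \ R) := by
    rw [← hcard_sdiff, card_pos, sdiff_nonempty]
    exact fun hs => hne (eq_of_subset_of_card_le hs hcard.ge)
  calc ∑ t ∈ R \ P, (t : ℕ) ≤ #(R \ P) • (b : ℕ) := sum_le_card_nsmul _ _ _ hR
    _ < #(P \ R) • (a : ℕ) := by
        rw [hcard_sdiff, smul_eq_mul, smul_eq_mul]
        exact Nat.mul_lt_mul_of_pos_left hba hpos
    _ ≤ ∑ t ∈ P \ R, (t : ℕ) :=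
        card_nsmul_le_sum _ _ _ fun t ht => hP t (mem_sdiff.1 ht).1

theorem sort_map_compl_append_sort_map_perm (J : Fin m ↪o Fin n) (S : Finset (Fin m)) :
    ((Sᶜ.map J.toEmbedding).sort (· ≤ ·) ++ (S.map J.toEmbedding).sort (· ≤ ·)).Perm
      (List.ofFn J) := by
  rw [← sort_map_univ, ← Multiset.coe_eq_coe, ← Multiset.coe_add, sort_eq, sort_eq, sort_eq,
    map_val, map_val, map_val, ← Multiset.map_add]
  exact congrArg (fun U : Finset (Fin m) => U.val.map J)
    ((disjUnion_eq_union Sᶜ S disjoint_compl_left).trans compl_sup_eq_top)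

/-- The exchange relation applied to the entries of `A` from place `i` on and the entries of `B`
up to place `i`: these are `m + 1` distinct columns, and every other way of distributing them
moves smaller columns to the left. -/
theorem maxMinor_mul_maxMinor_mem_span (hq : q ≠ 0) {A B : Fin m ↪o Fin n} {i : Fin m}
    (hi : B i < A i) :
    maxMinor q A * maxMinor q B ∈ Submodule.span k
      {y | ∃ A' B' : Fin m ↪o Fin n, rowSum A' < rowSum A ∧
        rowSum A' + rowSum B' = rowSum A + rowSum B ∧ y = maxMinor q A' * maxMinor q B'} := by
  let P : Finset (Fin n) := (Ici i).map A.toEmbedding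
  let Q : Finset (Fin n) := (Iic i).map B.toEmbedding
  have hP : ∀ t ∈ P, A i ≤ t := by simp [P]
  have hQ : ∀ t ∈ Q, t ≤ B i := by simp [Q]
  have hPQ : Disjoint P Q := disjoint_left.2 fun t htP htQ =>
    ((hP t htP).trans (hQ t htQ)).not_gt hi
  have hcard : m < #(P ∪ Q) := by
    rw [card_union_of_disjoint hPQ, card_map, card_map, Fin.card_Ici, Fin.card_Iic]
    omega
  have hA : (_ ++ P.sort (· ≤ ·)).Perm (List.ofFn A) :=
    sort_map_compl_append_sort_map_perm A (Ici i)
  have hB : (_ ++ Q.sort (· ≤ ·)).Perm (List.ofFn B) :=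
    sort_map_compl_append_sort_map_perm B (Iic i)
  refine Submodule.span_mono ?_ (maxMinor_mul_maxMinor_mem_span_of_perm hq hPQ hcard hA hB)
  rintro _ ⟨A', B', R, hR, hne, hA', hB', rfl⟩
  have hcardR : #R = #P := by
    have hlengthA' := hA'.length_eq
    have hlengthA := hA.length_eq
    simp only [List.length_append, length_sort, List.length_ofFn] at hlengthA' hlengthA
    omega
  have hlt : ∑ t ∈ R, (t : ℕ) < ∑ t ∈ P, (t : ℕ) :=
    sum_lt_sum_of_card_eq hi hcardR hne (fun t ht => hQ t ?_) hP
  · refine ⟨A', B', ?_, ?_, rfl⟩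
    · rw [rowSum_eq_of_perm hA', rowSum_eq_of_perm hA]
      exact Nat.add_lt_add_left hlt _
    · have hsum := (sum_sdiff (f := fun t : Fin n => (t : ℕ)) hR).trans (sum_union hPQ)
      rw [rowSum_eq_of_perm hA', rowSum_eq_of_perm hA, rowSum_eq_of_perm hB',
        rowSum_eq_of_perm hB]
      omega
  · exact (mem_union.1 (hR (mem_sdiff.1 ht).1)).resolve_left (mem_sdiff.1 ht).2

/-- The sum of the entries of a tableau, each counted with the number of rows from its own
row downwards. It decreases when a product of two neighbouring rows is straightened. -/
def Tableau.height : Tableau m n → ℕ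
  | [] => 0
  | J :: T => (T.length + 1) * rowSum J + Tableau.height T

theorem Tableau.height_lt {A B A' B' : Fin m ↪o Fin n} (h : rowSum A' < rowSum A)
    (h' : rowSum A' + rowSum B' = rowSum A + rowSum B) (U V : Tableau m n) :
    Tableau.height (U ++ A' :: B' :: V) < Tableau.height (U ++ A :: B :: V) := by
  induction U with
  | nil =>
    simp only [List.nil_append, Tableau.height, List.length_cons]
    have e := congrArg ((V.length + 1) * ·) h'
    simp only [mul_add] at e
    rw [add_mul (V.length + 1) 1, add_mul (V.length + 1) 1]
    omega
  | cons J U ih =>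
    simp only [List.cons_append, Tableau.height, List.length_append, List.length_cons]
    omega

theorem coe_tableauProduct (T : Tableau m n) :
    (tableauProduct q T : QMatrix q m n) = (T.map fun J => maxMinor q J).prod := by
  rw [tableauProduct, ← Subalgebra.coe_val, map_list_prod, List.map_map]
  rfl

theorem prod_maxMinor_mem_span (hq : q ≠ 0) (T : Tableau m n) :
    (T.map fun J => maxMinor q J).prod ∈ Submodule.span k
      (Set.range fun T : {T : Tableau m n // T.Preferred} =>
        (T.1.map fun J => maxMinor q J).prod) := by
  induction hN : T.height using Nat.strong_induction_on generalizing T with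
  | _ N ih =>
  by_cases hT : T.Preferred
  · exact Submodule.subset_span ⟨⟨T, hT⟩, rfl⟩
  rw [Tableau.Preferred, List.isChain_iff_forall_rel_of_append_cons_cons] at hT
  push Not at hT
  obtain ⟨A, B, U, V, rfl, hAB⟩ := hT
  obtain ⟨i, hi⟩ : ∃ i, B i < A i := by simpa [StarLE] using hAB
  let φ : QMatrix q m n →ₗ[k] QMatrix q m n :=
    LinearMap.mulLeftRight k ((U.map fun J => maxMinor q J).prod,
      (V.map fun J => maxMinor q J).prod)
  have hφ (A B : Fin m ↪o Fin n) : φ (maxMinor q A * maxMinor q B) =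
      ((U ++ A :: B :: V).map fun J => maxMinor q J).prod := by
    simp [φ, mul_assoc]
  rw [← hφ, ← Submodule.mem_comap]
  refine Submodule.span_le.2 ?_ (maxMinor_mul_maxMinor_mem_span hq hi)
  rintro _ ⟨A', B', hlt, heq, rfl⟩
  rw [SetLike.mem_coe, Submodule.mem_comap, hφ]
  exact ih _ (hN ▸ Tableau.height_lt hlt heq U V) _ rfl

theorem span_tableauProduct (hq : q ≠ 0) :
    Submodule.span k (Set.range fun T : {T : Tableau m n // T.Preferred} =>
      tableauProduct q T.1) = ⊤ := by
  rw [eq_top_iff, ← Submodule.map_le_map_iff_of_injective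
    (f := (grassmannian q m n).val.toLinearMap) Subtype.val_injective, Submodule.map_span,
    ← Set.range_comp, Submodule.map_top]
  rintro _ ⟨⟨y, hy⟩, rfl⟩
  replace hy : y ∈ Subalgebra.toSubmodule (Algebra.adjoin k _) := hy
  rw [Algebra.adjoin_eq_span] at hy
  refine Submodule.span_le.2 (fun z hz => ?_) hy
  obtain ⟨l, hl, rfl⟩ := Submonoid.exists_list_of_mem_closure hz
  obtain ⟨T, rfl⟩ : l ∈ Set.range (List.map fun J : Fin m ↪o Fin n => maxMinor q J) := by
    rwa [Set.range_list_map]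
  simpa only [Function.comp_def, AlgHom.toLinearMap_apply, Subalgebra.coe_val,
    coe_tableauProduct, SetLike.mem_coe] using prod_maxMinor_mem_span hq T

end Straightening

section HomogeneousBasis

variable {k ι α M : Type*} [Field k] [AddCommGroup M] [Module k M] {V : ι → Submodule k M}
  {f : α → M} {deg : α → ι}

theorem linearIndependent_of_fiber (hV : iSupIndep V) (hf : ∀ a, f a ∈ V (deg a))
    (hli : ∀ i, LinearIndependent k fun a : {a // deg a = i} => f a) :
    LinearIndependent k f := by
  have hle : ∀ i, Submodule.span k (Set.range fun a : {a // deg a = i} => f a) ≤ V i := by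
    intro i
    rw [Submodule.span_le]
    rintro _ ⟨⟨a, rfl⟩, rfl⟩
    exact hf a
  have hsigma := linearIndependent_iUnion_finite hli fun i t _ hit =>
    (hV.mono hle).disjoint_biSup hit
  exact hsigma.comp (Equiv.sigmaFiberEquiv deg).symm (Equiv.injective _)

theorem span_fiber_eq (hV : iSupIndep V) (hf : ∀ a, f a ∈ V (deg a))
    (hspan : Submodule.span k (Set.range f) = ⊤) (i : ι) :
    Submodule.span k (Set.range fun a : {a // deg a = i} => f a) = V i := by
  revert i
  rw [← funext_iff, ← hV.le_iff_eq_of_iSup_eq_top]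
  · intro i
    rw [Submodule.span_le]
    rintro _ ⟨⟨a, rfl⟩, rfl⟩
    exact hf a
  · rw [eq_top_iff, ← hspan, Submodule.span_le]
    rintro _ ⟨a, rfl⟩
    exact Submodule.mem_iSup_of_mem (deg a) (Submodule.subset_span ⟨⟨a, rfl⟩, rfl⟩)

theorem exists_basis_component (hV : iSupIndep V) (hf : ∀ a, f a ∈ V (deg a))
    (hli : LinearIndependent k f) (hspan : Submodule.span k (Set.range f) = ⊤) (i : ι) :
    ∃ b : Module.Basis {a // deg a = i} k (V i), ∀ a, (b a : M) = f a := by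
  refine ⟨(Module.Basis.span (hli.comp _ Subtype.val_injective)).map
    (LinearEquiv.ofEq _ _ (span_fiber_eq hV hf hspan i)), fun a => ?_⟩
  rw [Module.Basis.map_apply, LinearEquiv.coe_ofEq_apply, Module.Basis.span_apply]
  rfl

end HomogeneousBasis

section Grading

variable {k : Type*} [Field k] {q : k} {m n : ℕ}

theorem wordDegree_append (u v : List (Fin m × Fin n)) :
    wordDegree (u ++ v) = wordDegree u + wordDegree v := by
  simp [wordDegree]

instance instGradedMonoidMatrixComponent (q : k) (m n : ℕ) :
    SetLike.GradedMonoid (matrixComponent q m n) where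
  one_mem := Submodule.subset_span ⟨[], by simp [wordDegree], by simp⟩
  mul_mem d d' y z hy hz := by
    have h := Submodule.mul_mem_mul hy hz
    rw [matrixComponent, matrixComponent, Submodule.span_mul_span] at h
    refine Submodule.span_mono ?_ h
    rintro _ ⟨_, ⟨u, rfl, rfl⟩, _, ⟨v, rfl, rfl⟩, rfl⟩
    exact ⟨u ++ v, wordDegree_append u v, by simp⟩

theorem IsQuantumMatrix.single {ι κ A G : Type*} [Preorder ι] [Preorder κ] [Ring A] [Algebra k A]
    [AddCommMonoid G] {x : Matrix ι κ A} (h : IsQuantumMatrix q x) (d : κ → G) :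
    IsQuantumMatrix q (Matrix.of fun i j => AddMonoidAlgebra.single (d j) (x i j)) where
  row i j l hj := by
    simp only [Matrix.of_apply, AddMonoidAlgebra.single_mul_single, AddMonoidAlgebra.smul_single,
      h.row i j l hj, add_comm (d j)]
  col i i' j hi := by
    simp only [Matrix.of_apply, AddMonoidAlgebra.single_mul_single, AddMonoidAlgebra.smul_single,
      h.col i i' j hi]
  anti i i' j l hi hj := by
    simp only [Matrix.of_apply, AddMonoidAlgebra.single_mul_single, h.anti i i' j l hi hj,
      add_comm (d j)]
  diag i i' j l hi hj := by
    simp only [Matrix.of_apply, AddMonoidAlgebra.single_mul_single, AddMonoidAlgebra.smul_single,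
      add_comm (d l), ← h.diag i i' j l hi hj, AddMonoidAlgebra.single_sub]

/-- The coaction of the torus: multiplicative because the relations are homogeneous, it separates
the components by construction. -/
theorem exists_coaction (q : k) (m n : ℕ) :
    ∃ δ : QMatrix q m n →ₐ[k] AddMonoidAlgebra (QMatrix q m n) (Fin n → ℤ),
      ∀ d, ∀ y ∈ matrixComponent q m n d, δ y = AddMonoidAlgebra.single d y := by
  obtain ⟨δ, hδ⟩ := ((isQuantumMatrix_generatorMatrix q m n).single
    fun j : Fin n => (Pi.single j 1 : Fin n → ℤ)).exists_algHom
  have hword (u : List (Fin m × Fin n)) : δ (u.map fun p => X q p.1 p.2).prod =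
      AddMonoidAlgebra.single (wordDegree u) (u.map fun p => X q p.1 p.2).prod := by
    induction u with
    | nil => simp [wordDegree, AddMonoidAlgebra.one_def]
    | cons p u ih =>
      rw [List.map_cons, List.prod_cons, map_mul, hδ, ih]
      exact AddMonoidAlgebra.single_mul_single ..
  refine ⟨δ, fun d => LinearMap.eqOn_span (f := δ.toLinearMap)
    (g := AddMonoidAlgebra.lsingle d) ?_⟩
  rintro _ ⟨u, rfl, rfl⟩
  exact hword u

theorem iSupIndep_matrixComponent (q : k) (m n : ℕ) : iSupIndep (matrixComponent q m n) := by
  obtain ⟨δ, hδ⟩ := exists_coaction q m n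
  rw [iSupIndep_iff_finsetSum_eq_zero_imp_eq_zero]
  intro s v hv hsum i hi
  have hcoeff := congrArg (fun y => (δ y).coeff i) hsum
  simpa [sum_congr rfl fun i hi => hδ i (v i) (hv i hi), Finsupp.single_apply, hi] using hcoeff

theorem iSupIndep_comap {ι M N : Type*} [AddCommGroup M] [Module k M] [AddCommGroup N]
    [Module k N] {f : M →ₗ[k] N} (hf : Function.Injective f) {V : ι → Submodule k N}
    (hV : iSupIndep V) : iSupIndep fun i => (V i).comap f := by
  rw [iSupIndep_iff_finsetSum_eq_zero_imp_eq_zero] at hV ⊢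
  intro s v hv hsum i hi
  refine (map_eq_zero_iff f hf).1 (hV s (f ∘ v) hv ?_ i hi)
  simpa only [map_sum, map_zero, Function.comp_apply] using congrArg f hsum

theorem iSupIndep_grassmannianComponent (q : k) (m n : ℕ) :
    iSupIndep (grassmannianComponent q m n) :=
  iSupIndep_comap Subtype.val_injective (iSupIndep_matrixComponent q m n)

theorem Tableau.content_cons (J : Fin m ↪o Fin n) (T : Tableau m n) :
    Tableau.content (J :: T) = univ.val.map J + T.content := rfl

theorem maxMinor_mem_matrixComponent (J : Fin m ↪o Fin n) :
    maxMinor q J ∈ matrixComponent q m n (∑ a, Pi.single (J a) 1) := by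
  refine Submodule.sum_mem _ fun σ _ => Submodule.smul_mem _ _ (Submodule.subset_span ?_)
  refine ⟨List.ofFn fun a => (a, J (σ a)), ?_, by simp only [List.map_ofFn]; rfl⟩
  rw [Set.mem_ofPred_eq, wordDegree, List.map_ofFn, List.sum_ofFn]
  exact Equiv.sum_comp σ fun a => (Pi.single (J a) 1 : Fin n → ℤ)

/-- The degree of a product of generators whose column indices form the given multiset. -/
def multidegree (s : Multiset (Fin n)) : Fin n → ℤ := fun j => s.count j

theorem multidegree_injective : Function.Injective (multidegree (n := n)) := fun _ _ h =>
  Multiset.ext.2 fun j => Nat.cast_injective (congrFun h j)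

theorem multidegree_multisetOf (c : Fin n → ℕ) :
    multidegree (multisetOf c) = fun j => (c j : ℤ) := by
  ext j
  simp [multidegree, multisetOf, Multiset.count_sum', Multiset.count_replicate]

theorem tableauProduct_mem_grassmannianComponent (T : Tableau m n) :
    tableauProduct q T ∈ grassmannianComponent q m n (multidegree T.content) := by
  have hdegree : (T.map fun J => ∑ a, (Pi.single (J a) 1 : Fin n → ℤ)).sum =
      multidegree T.content := by
    induction T with
    | nil => simp [Tableau.content, multidegree, funext_iff]
    | cons J T ih =>
      rw [List.map_cons, List.sum_cons, ih]
      ext j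
      rw [multidegree, Tableau.content_cons, Multiset.count_add, Multiset.count_map,
        ← filter_val, card_val]
      simp [multidegree, Pi.single_apply]
  rw [grassmannianComponent, Submodule.mem_comap, AlgHom.toLinearMap_apply, Subalgebra.coe_val,
    coe_tableauProduct, ← hdegree]
  exact SetLike.list_prod_map_mem_graded T _ _ fun J _ => maxMinor_mem_matrixComponent J

theorem Tableau.card_content (T : Tableau m n) : T.content.card = T.length * m := by
  induction T with
  | nil => simp [Tableau.content]
  | cons J T ih =>
    rw [Tableau.content_cons, Multiset.card_add, ih, Multiset.card_map, card_val, card_fin,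
      List.length_cons]
    ring

end Grading

section MatrixProduct

variable {k ι κ μ A : Type*} [Field k] [Ring A] [Algebra k A] {q : k}

theorem IsQuantumMatrix.submatrix {ι' κ' : Type*} [Preorder ι] [Preorder κ] [Preorder ι']
    [Preorder κ'] {x : Matrix ι κ A} (h : IsQuantumMatrix q x) {f : ι' → ι} {g : κ' → κ}
    (hf : StrictMono f) (hg : StrictMono g) : IsQuantumMatrix q (x.submatrix f g) where
  row _ _ _ hj := h.row _ _ _ (hg hj)
  col _ _ _ hi := h.col _ _ _ (hf hi)
  anti _ _ _ _ hi hj := h.anti _ _ _ _ (hf hi) (hg hj)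
  diag _ _ _ _ hi hj := h.diag _ _ _ _ (hf hi) (hg hj)

variable [LinearOrder ι] [LinearOrder κ] [LinearOrder μ]

theorem commute_one_apply_one_apply (i i' j j' : ι) :
    Commute ((1 : Matrix ι ι A) i j) ((1 : Matrix ι ι A) i' j') := by
  simp only [Matrix.one_apply]
  split_ifs <;> simp

theorem IsQuantumMatrix.one : IsQuantumMatrix q (1 : Matrix ι ι A) where
  row i j l hj := by
    rcases eq_or_ne i j with rfl | h
    · simp [hj.ne]
    · simp [h]
  col i i' j hi := by
    rcases eq_or_ne i j with rfl | h
    · simp [hi.ne']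
    · simp [h]
  anti i i' j l _ _ := commute_one_apply_one_apply i i' l j
  diag i i' j l hi hj := by
    rw [(commute_one_apply_one_apply i i' j l).eq, sub_self]
    rcases eq_or_ne i l with rfl | h
    · simp [(hj.trans hi).ne']
    · simp [h]

/-- The coefficient of the flip in the Hecke `R`-matrix, applied to the basis vectors `a`
and `b`. -/
def rFlip (q : k) (a b : ι) : k := if a = b then q else 1

/-- The coefficient of the identity in the Hecke `R`-matrix, applied to the basis vectors `a`
and `b`. -/
def rId (q : k) (a b : ι) : k := if a < b then q - q⁻¹ else 0

theorem rFlip_comm (q : k) (a b : ι) : rFlip q a b = rFlip q b a := by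
  simp only [rFlip, eq_comm]

/-- The relations of quantum matrices in the form `R x₁ x₂ = x₂ x₁ R` of Faddeev, Reshetikhin and
Takhtajan, written out in coordinates. In this form they are inherited by products. -/
def IsRTT (q : k) (x : Matrix ι κ A) : Prop := ∀ i i' j l,
  rFlip q i i' • (x i' j * x i l) + rId q i i' • (x i j * x i' l) =
    rFlip q j l • (x i l * x i' j) + rId q j l • (x i j * x i' l)

theorem IsRTT.isQuantumMatrix {x : Matrix ι κ A} (h : IsRTT q x) : IsQuantumMatrix q x := by
  have anti : ∀ i i' j l, i < i' → j < l → x i l * x i' j = x i' j * x i l := by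
    intro i i' j l hi hj
    simpa [rFlip, rId, hi.ne', hj.ne', hi.not_gt, hj.not_gt] using h i' i l j
  refine ⟨fun i j l hj => ?_, fun i i' j hi => ?_, anti, fun i i' j l hi hj => ?_⟩
  · simpa [rFlip, rId, hj.ne', hj.not_gt] using (h i i l j).symm
  · simpa [rFlip, rId, hi.ne', hi.not_gt] using h i' i j j
  · rw [anti i i' j l hi hj, sub_eq_iff_eq_add, add_comm]
    simpa [rFlip, rId, hi.ne', hj.ne, hi.not_gt, hj] using h i' i j l

theorem IsQuantumMatrix.isRTT (hq : q ≠ 0) {x : Matrix ι κ A} (h : IsQuantumMatrix q x) :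
    IsRTT q x := by
  have hecke {y z : A} (hyz : y = q • z) : z + (q - q⁻¹) • y = q • y := by
    rw [hyz, sub_smul, smul_smul q⁻¹, inv_mul_cancel₀ hq, one_smul]
    abel
  intro i i' j l
  rcases lt_trichotomy i i' with hi | rfl | hi <;> rcases lt_trichotomy j l with hj | rfl | hj
  · simp [rFlip, rId, hi.ne, hj.ne, hi, hj, h.anti i i' j l hi hj]
  · simp [rFlip, rId, hi.ne, hi, hecke (h.col i i' j hi)]
  · simp [rFlip, rId, hi.ne, hj.ne', hi, hj.not_gt, sub_eq_iff_eq_add.1 (h.diag i i' l j hi hj),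
      add_comm]
  · simp [rFlip, rId, hj.ne, hj, hecke (h.row i j l hj)]
  · simp [rFlip, rId]
  · simp [rFlip, rId, hj.ne', hj.not_gt, (h.row i l j hj).symm]
  · simp [rFlip, rId, hi.ne', hj.ne, hi.not_gt, hj, sub_eq_iff_eq_add.1 (h.diag i' i j l hi hj),
      h.anti i' i j l hi hj, add_comm]
  · simp [rFlip, rId, hi.ne', hi.not_gt, h.col i' i j hi]
  · simp [rFlip, rId, hi.ne', hj.ne', hi.not_gt, hj.not_gt, h.anti i' i l j hi hj]

theorem IsRTT.mul [Fintype κ] {x : Matrix ι κ A} {y : Matrix κ μ A} (hx : IsRTT q x)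
    (hy : IsRTT q y) (hxy : ∀ i j j' l, Commute (x i j) (y j' l)) : IsRTT q (x * y) := by
  intro i i' j l
  have entry_mul_entry (i i' : ι) (j l : μ) : (x * y) i j * (x * y) i' l =
      ∑ a, ∑ b, x i a * x i' b * (y a j * y b l) := by
    simp only [Matrix.mul_apply, sum_mul_sum]
    exact sum_congr rfl fun a _ => sum_congr rfl fun b _ => (hxy i' b a j).symm.mul_mul_mul_comm ..
  simp only [entry_mul_entry, smul_sum, ← sum_add_distrib]
  calc ∑ a, ∑ b, (rFlip q i i' • (x i' a * x i b * (y a j * y b l)) +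
        rId q i i' • (x i a * x i' b * (y a j * y b l)))
    _ = ∑ a, ∑ b, (rFlip q a b • (x i b * x i' a * (y a j * y b l)) +
        rId q a b • (x i a * x i' b * (y a j * y b l))) :=
        sum_congr rfl fun a _ => sum_congr rfl fun b _ => by
          simpa only [add_mul, smul_mul_assoc] using congrArg (· * (y a j * y b l)) (hx i i' a b)
    _ = ∑ a, ∑ b, (rFlip q a b • (x i a * x i' b * (y b j * y a l)) +
        rId q a b • (x i a * x i' b * (y a j * y b l))) := by
        simp only [sum_add_distrib]
        congr 1
        rw [sum_comm]
        exact sum_congr rfl fun a _ => sum_congr rfl fun b _ => by rw [rFlip_comm]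
    _ = _ := sum_congr rfl fun a _ => sum_congr rfl fun b _ => by
        simpa only [mul_add, mul_smul_comm] using congrArg (x i a * x i' b * ·) (hy a b j l)

theorem IsQuantumMatrix.mul (hq : q ≠ 0) [Fintype κ] {x : Matrix ι κ A} {y : Matrix κ μ A}
    (hx : IsQuantumMatrix q x) (hy : IsQuantumMatrix q y)
    (hxy : ∀ i j j' l, Commute (x i j) (y j' l)) : IsQuantumMatrix q (x * y) :=
  ((hx.isRTT hq).mul (hy.isRTT hq) hxy).isQuantumMatrix

end MatrixProduct

section LeadingExponent

variable {k E M : Type*} [Field k] [AddCommMonoid E] [AddCommGroup M] [Module k M]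
  (β : Module.Basis E k M)

/-- The weighted shift by `e` on a vector space with basis indexed by `E`. -/
noncomputable def shiftOp (c : E → k) (e : E) : Module.End k M :=
  β.constr k fun v => c v • β (v + e)

theorem shiftOp_basis (c : E → k) (e v : E) : shiftOp β c e (β v) = c v • β (v + e) :=
  β.constr_basis k _ v

theorem shiftOp_mul (c c' : E → k) (e e' : E) :
    shiftOp β c e * shiftOp β c' e' = shiftOp β (fun v => c' v * c (v + e')) (e' + e) := by
  refine β.ext fun v => ?_
  rw [Module.End.mul_apply, shiftOp_basis, map_smul, shiftOp_basis, shiftOp_basis, smul_smul,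
    add_assoc]

theorem smul_shiftOp (r : k) (c : E → k) (e : E) :
    r • shiftOp β c e = shiftOp β (fun v => r * c v) e := by
  refine β.ext fun v => ?_
  rw [LinearMap.smul_apply, shiftOp_basis, shiftOp_basis, smul_smul]

theorem shiftOp_one : shiftOp β (fun _ => 1) 0 = 1 := by
  refine β.ext fun v => ?_
  rw [shiftOp_basis, one_smul, add_zero, Module.End.one_apply]

variable (w : E →+ ℤ)

/-- The span of the basis vectors of weight at most `t`. -/
def weightLE (t : ℤ) : Submodule k M := Submodule.span k (β '' {v | w v ≤ t})

/-- The operators that raise weights by at most `h`. -/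
def raisesLE (h : ℤ) : Submodule k (Module.End k M) :=
  ⨅ t, Submodule.compatibleMaps (weightLE β w t) (weightLE β w (t + h))

/-- The operator `x` is a weighted shift by `e` with nonzero coefficients, up to terms of smaller
weight. -/
def IsLead (e : E) (x : Module.End k M) : Prop :=
  ∃ c : E → k, (∀ v, c v ≠ 0) ∧ x - shiftOp β c e ∈ raisesLE β w (w e - 1)

variable {β w}

theorem weightLE_mono : Monotone (weightLE β w) := fun _ _ h =>
  Submodule.span_mono (Set.image_mono fun _ hv => le_trans hv h)

theorem mem_raisesLE_iff {h : ℤ} {x : Module.End k M} :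
    x ∈ raisesLE β w h ↔ ∀ t, ∀ f ∈ weightLE β w t, x f ∈ weightLE β w (t + h) := by
  rw [raisesLE, Submodule.mem_iInf]
  rfl

theorem raisesLE_mono : Monotone (raisesLE β w) := fun _ _ h _ hx =>
  mem_raisesLE_iff.2 fun t f hf => weightLE_mono (by omega) (mem_raisesLE_iff.1 hx t f hf)

theorem mul_mem_raisesLE {h h' : ℤ} {x y : Module.End k M} (hx : x ∈ raisesLE β w h)
    (hy : y ∈ raisesLE β w h') : x * y ∈ raisesLE β w (h + h') := by
  rw [mem_raisesLE_iff] at hx hy ⊢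
  intro t f hf
  rw [add_comm h, ← add_assoc]
  exact hx _ _ (hy t f hf)

theorem shiftOp_mem_raisesLE (c : E → k) (e : E) : shiftOp β c e ∈ raisesLE β w (w e) := by
  rw [mem_raisesLE_iff]
  intro t
  change weightLE β w t ≤ (weightLE β w (t + w e)).comap (shiftOp β c e)
  refine Submodule.span_le.2 ?_
  rintro _ ⟨v, hv, rfl⟩
  rw [SetLike.mem_coe, Submodule.mem_comap, shiftOp_basis]
  refine Submodule.smul_mem _ _ (Submodule.subset_span ⟨v + e, ?_, rfl⟩)
  simpa only [Set.mem_ofPred_eq, map_add, add_le_add_iff_right] using hv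

theorem IsLead.mem_raisesLE {e : E} {x : Module.End k M} (hx : IsLead β w e x) :
    x ∈ raisesLE β w (w e) := by
  obtain ⟨c, _, h⟩ := hx
  simpa only [sub_add_cancel] using
    add_mem (raisesLE_mono (sub_le_self _ one_pos.le) h) (shiftOp_mem_raisesLE c e)

theorem isLead_shiftOp {c : E → k} (hc : ∀ v, c v ≠ 0) (e : E) :
    IsLead β w e (shiftOp β c e) :=
  ⟨c, hc, by rw [sub_self]; exact zero_mem _⟩

theorem isLead_one : IsLead β w 0 (1 : Module.End k M) := by
  rw [← shiftOp_one β]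
  exact isLead_shiftOp (fun _ => one_ne_zero) 0

theorem IsLead.add {e : E} {x y : Module.End k M} (hx : IsLead β w e x)
    (hy : y ∈ raisesLE β w (w e - 1)) : IsLead β w e (x + y) := by
  obtain ⟨c, hc, h⟩ := hx
  refine ⟨c, hc, ?_⟩
  rw [add_sub_right_comm]
  exact add_mem h hy

theorem IsLead.mul {e e' : E} {x y : Module.End k M} (hx : IsLead β w e x)
    (hy : IsLead β w e' y) : IsLead β w (e + e') (x * y) := by
  have hy' := hy.mem_raisesLE
  obtain ⟨c, hc, h⟩ := hx
  obtain ⟨c', hc', h'⟩ := hy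
  refine ⟨_, fun v => mul_ne_zero (hc' v) (hc (v + e')), ?_⟩
  have hdiff : x * y - shiftOp β (fun v => c' v * c (v + e')) (e + e') =
      (x - shiftOp β c e) * y + shiftOp β c e * (y - shiftOp β c' e') := by
    rw [add_comm e, ← shiftOp_mul, sub_mul, mul_sub]
    abel
  rw [hdiff, map_add]
  exact add_mem (raisesLE_mono (by omega) (mul_mem_raisesLE h hy'))
    (raisesLE_mono (by omega) (mul_mem_raisesLE (shiftOp_mem_raisesLE c e) h'))

theorem IsLead.list_prod {α : Type*} {e : α → E} {x : α → Module.End k M} {l : List α}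
    (h : ∀ a ∈ l, IsLead β w (e a) (x a)) : IsLead β w (l.map e).sum (l.map x).prod := by
  induction l with
  | nil => exact isLead_one
  | cons a l ih =>
    simp only [List.map_cons, List.sum_cons, List.prod_cons]
    exact (h a (by simp)).mul (ih fun b hb => h b (by simp [hb]))

theorem list_prod_mem_raisesLE {α : Type*} {e : α → ℤ} {x : α → Module.End k M} {l : List α}
    (h : ∀ a ∈ l, x a ∈ raisesLE β w (e a)) : (l.map x).prod ∈ raisesLE β w (l.map e).sum := by
  induction l with
  | nil => simpa using (isLead_one (β := β) (w := w)).mem_raisesLE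
  | cons a l ih =>
    simp only [List.map_cons, List.sum_cons, List.prod_cons]
    exact mul_mem_raisesLE (h a (by simp)) (ih fun b hb => h b (by simp [hb]))

theorem IsLead.exists_repr_eq {e : E} {x : Module.End k M} (hx : IsLead β w e x) :
    ∃ c : k, c ≠ 0 ∧ ∀ v, w e ≤ w v → β.repr (x (β 0)) v = Finsupp.single e c v := by
  obtain ⟨c, hc, h⟩ := hx
  refine ⟨c 0, hc 0, fun v hv => ?_⟩
  have hmem := mem_raisesLE_iff.1 h 0 (β 0)
    (Submodule.subset_span ⟨0, by simp, rfl⟩)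
  rw [LinearMap.sub_apply, shiftOp_basis, zero_add, zero_add, weightLE,
    β.mem_span_image] at hmem
  have hzero : β.repr (x (β 0) - c 0 • β e) v = 0 := by
    by_contra hne
    have hlt : w v ≤ w e - 1 := hmem (Finsupp.mem_support_iff.2 hne)
    omega
  rw [map_sub, Finsupp.sub_apply, sub_eq_zero] at hzero
  simpa using hzero

/-- In a linear relation, the exponent of largest weight occurs in one term only. -/
theorem linearIndependent_of_isLead {α : Type*} {e : α → E} (he : Function.Injective e)
    {x : α → Module.End k M} (hx : ∀ a, IsLead β w (e a) (x a)) :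
    LinearIndependent k fun a => x a (β 0) := by
  classical
  choose c hc hrepr using fun a => (hx a).exists_repr_eq
  rw [linearIndependent_iff']
  intro s g hg
  by_contra! ⟨a₀, ha₀, hga₀⟩
  obtain ⟨b, hb, hmax⟩ := exists_max_image {a ∈ s | g a ≠ 0} (fun a => w (e a))
    ⟨a₀, mem_filter.2 ⟨ha₀, hga₀⟩⟩
  rw [mem_filter] at hb
  refine mul_ne_zero hb.2 (hc b) ?_
  calc g b * c b = ∑ a ∈ s, g a * β.repr (x a (β 0)) (e b) := by
        rw [sum_eq_single_of_mem b hb.1, hrepr b _ le_rfl, Finsupp.single_eq_same]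
        intro a ha hab
        rcases eq_or_ne (g a) 0 with hga | hga
        · rw [hga, zero_mul]
        · rw [hrepr a _ (hmax a (mem_filter.2 ⟨ha, hga⟩)),
            Finsupp.single_eq_of_ne (he.ne hab.symm), mul_zero]
    _ = β.repr (∑ a ∈ s, g a • x a (β 0)) (e b) := by
        simp [map_sum, Finsupp.finsetSum_apply]
    _ = 0 := by rw [hg, map_zero, Finsupp.zero_apply]

end LeadingExponent

section PathModel

/-- Exponents of monomials in variables indexed by pairs of natural numbers. -/
abbrev Expo : Type := ℕ × ℕ →₀ ℕ

/-- The weight in which the variable indexed by `(p, b)` has weight `p`. -/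
noncomputable def expoWeight : Expo →+ ℤ := Finsupp.weight fun p : ℕ × ℕ => (p.1 : ℤ)

/-- The exponent of the product of the variables indexed by `(p, b)` with `j < b ≤ l`. -/
noncomputable def seg (p j l : ℕ) : Expo := ∑ b ∈ Ioc j l, Finsupp.single (p, b) 1

theorem seg_apply (p j l p' b : ℕ) :
    seg p j l (p', b) = if p = p' ∧ j < b ∧ b ≤ l then 1 else 0 := by
  rw [seg, Finsupp.finsetSum_apply]
  by_cases h : p = p'
  · subst h
    simp [Finsupp.single_apply]
  · simp [h]

theorem seg_self (p j : ℕ) : seg p j j = 0 := by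
  rw [seg, Ioc_self, sum_empty]

theorem seg_add_seg {p j j' l l' : ℕ} (h₁ : j ≤ l) (h₂ : j ≤ l') (h₃ : j' ≤ l) (h₄ : j' ≤ l') :
    seg p j l + seg p j' l' = seg p j l' + seg p j' l := by
  ext ⟨p', b⟩
  simp only [Finsupp.add_apply, seg_apply]
  split_ifs <;> omega

theorem expoWeight_seg {p j l : ℕ} (h : j ≤ l) :
    expoWeight (seg p j l) = p * ((l : ℤ) - j) := by
  simp [expoWeight, seg, map_sum, Finsupp.weight_single, h, mul_comm]

variable {k M : Type*} [Field k] [AddCommGroup M] [Module k M] (β : Module.Basis Expo k M)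

/-- The shift by `e` weighted with powers of `q`. -/
noncomputable def qShift (q : k) (a : Expo → ℤ) (e : Expo) : Module.End k M :=
  shiftOp β (fun v => q ^ a v) e

/-- The operator that multiplies by the monomial `seg p j l` and rescales by powers of `q`. The
power is the difference of the exponents of the variables that follow the end points of the
segment and is chosen such that the `segOp` satisfy the relations of quantum matrices. -/
noncomputable def segOp (q : k) (p j l : ℕ) : Module.End k M :=
  qShift β q (fun v => (v (p, l + 1) : ℤ) - v (p, j)) (seg p j l)

variable {β} {q : k} {n : ℕ}

theorem qShift_mul (hq : q ≠ 0) (a a' : Expo → ℤ) (e e' : Expo) :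
    qShift β q a e * qShift β q a' e' = qShift β q (fun v => a' v + a (v + e')) (e' + e) := by
  simp only [qShift, shiftOp_mul, zpow_add₀ hq]

theorem smul_qShift (hq : q ≠ 0) (a : Expo → ℤ) (e : Expo) :
    q • qShift β q a e = qShift β q (fun v => a v + 1) e := by
  simp only [qShift, smul_shiftOp, zpow_add_one₀ hq, mul_comm q]

theorem inv_smul_qShift (hq : q ≠ 0) (a : Expo → ℤ) (e : Expo) :
    q⁻¹ • qShift β q a e = qShift β q (fun v => a v - 1) e := by
  simp only [qShift, smul_shiftOp, zpow_sub_one₀ hq, mul_comm q⁻¹]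

theorem qShift_congr {a a' : Expo → ℤ} {e e' : Expo} (ha : ∀ v, a v = a' v) (he : e = e') :
    qShift β q a e = qShift β q a' e' := by
  rw [funext ha, he]

theorem isLead_segOp (hq : q ≠ 0) (w : Expo →+ ℤ) (p j l : ℕ) :
    IsLead β w (seg p j l) (segOp β q p j l) :=
  isLead_shiftOp (fun _ => zpow_ne_zero _ hq) _

theorem segOp_mul_segOp (hq : q ≠ 0) (p p' j l j' l' : ℕ) :
    segOp β q p j l * segOp β q p' j' l' =
      qShift β q (fun v => (v (p', l' + 1) : ℤ) - v (p', j') + (v (p, l + 1) - v (p, j)) +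
        ((if p' = p ∧ j' ≤ l ∧ l < l' then 1 else 0) -
          if p' = p ∧ j' < j ∧ j ≤ l' then 1 else 0)) (seg p' j' l' + seg p j l) := by
  rw [segOp, segOp, qShift_mul hq]
  refine qShift_congr (fun v => ?_) rfl
  simp only [Finsupp.add_apply, seg_apply, Nat.lt_succ_iff, Nat.succ_le_iff]
  push_cast
  ring

theorem commute_segOp_of_ne (hq : q ≠ 0) {p p' : ℕ} (hp : p ≠ p') (j l j' l' : ℕ) :
    Commute (segOp β q p j l) (segOp β q p' j' l') := by
  rw [Commute, SemiconjBy, segOp_mul_segOp hq, segOp_mul_segOp hq]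
  refine qShift_congr (fun v => ?_) (add_comm _ _)
  simp only [hp, hp.symm, false_and, if_false]
  ring

theorem segOp_mul_segOp_row (hq : q ≠ 0) (p : ℕ) {i j l : ℕ} (hij : i ≤ j) (hjl : j < l) :
    segOp β q p i j * segOp β q p i l = q • (segOp β q p i l * segOp β q p i j) := by
  rw [segOp_mul_segOp hq, segOp_mul_segOp hq, smul_qShift hq]
  refine qShift_congr (fun v => ?_) (add_comm _ _)
  split_ifs <;> omega

theorem segOp_mul_segOp_col (hq : q ≠ 0) (p : ℕ) {i i' j : ℕ} (hi : i < i') (hj : i' ≤ j) :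
    segOp β q p i j * segOp β q p i' j = q • (segOp β q p i' j * segOp β q p i j) := by
  rw [segOp_mul_segOp hq, segOp_mul_segOp hq, smul_qShift hq]
  refine qShift_congr (fun v => ?_) (add_comm _ _)
  split_ifs <;> omega

theorem commute_segOp_of_nested (hq : q ≠ 0) (p : ℕ) {i i' j l : ℕ} (hi : i < i') (hij : i' ≤ j)
    (hj : j < l) : Commute (segOp β q p i l) (segOp β q p i' j) := by
  rw [Commute, SemiconjBy, segOp_mul_segOp hq, segOp_mul_segOp hq]
  refine qShift_congr (fun v => ?_) (add_comm _ _)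
  split_ifs <;> omega

theorem commute_segOp_of_disjoint (hq : q ≠ 0) (p : ℕ) {i i' j l : ℕ} (hij : i ≤ j)
    (hji : j < i') (hil : i' ≤ l) : Commute (segOp β q p i j) (segOp β q p i' l) := by
  rw [Commute, SemiconjBy, segOp_mul_segOp hq, segOp_mul_segOp hq]
  refine qShift_congr (fun v => ?_) (add_comm _ _)
  split_ifs <;> omega

theorem segOp_mul_segOp_diag (hq : q ≠ 0) (p : ℕ) {i i' j l : ℕ} (hi : i < i') (hij : i' ≤ j)
    (hj : j < l) : segOp β q p i j * segOp β q p i' l - segOp β q p i' l * segOp β q p i j =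
      (q - q⁻¹) • (segOp β q p i l * segOp β q p i' j) := by
  have hseg := seg_add_seg (p := p) (hi.le.trans (hij.trans hj.le)) (hi.le.trans hij)
    (hij.trans hj.le) hij
  rw [segOp_mul_segOp hq, segOp_mul_segOp hq, segOp_mul_segOp hq, sub_smul, smul_qShift hq,
    inv_smul_qShift hq]
  congr 1
  · refine qShift_congr (fun v => ?_) (by rw [add_comm, ← hseg, add_comm])
    split_ifs <;> omega
  · refine qShift_congr (fun v => ?_) (by rw [← hseg, add_comm])
    split_ifs <;> omega

variable (β q) in
/-- An upper triangular quantum matrix, equal to the identity in the rows before `p`. Taken at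
`q = 1`, its remaining entries are the ratios `t l / t j` for `t j` the product of the first `j`
variables of index `p`. -/
noncomputable def cell (p : ℕ) : Matrix (Fin n) (Fin n) (Module.End k M) := fun j l =>
  if j.val < p then (1 : Matrix (Fin n) (Fin n) (Module.End k M)) j l
  else if j ≤ l then segOp β q p j l else 0

theorem cell_of_lt (p : ℕ) {j l : Fin n} (h : l < j) : cell β q p j l = 0 := by
  simp [cell, h.ne', h.not_ge]

theorem cell_of_val_lt {p : ℕ} {j : Fin n} (h : j.val < p) (l : Fin n) :
    cell β q p j l = (1 : Matrix (Fin n) (Fin n) (Module.End k M)) j l := by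
  simp [cell, h]

theorem cell_of_le {p : ℕ} {j l : Fin n} (h : p ≤ j.val) (h' : j ≤ l) :
    cell β q p j l = segOp β q p j l := by
  simp [cell, h.not_gt, h']

theorem isQuantumMatrix_cell (hq : q ≠ 0) (p : ℕ) :
    IsQuantumMatrix q (cell β q p : Matrix (Fin n) (Fin n) (Module.End k M)) where
  row i j l hj := by
    rcases lt_or_ge i.val p with hp | hp
    · simpa only [cell_of_val_lt hp] using IsQuantumMatrix.one.row i j l hj
    rcases lt_or_ge j i with h | h
    · simp [cell_of_lt p h]
    rw [cell_of_le hp h, cell_of_le hp (h.trans hj.le)]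
    exact segOp_mul_segOp_row hq p h hj
  col i i' j hi := by
    rcases lt_or_ge j i' with h | h
    · simp [cell_of_lt p h]
    rcases lt_or_ge i.val p with hp | hp
    · simp [cell_of_val_lt hp, (hi.trans_le h).ne]
    rw [cell_of_le hp (hi.le.trans h), cell_of_le (hp.trans hi.le) h]
    exact segOp_mul_segOp_col hq p hi h
  anti i i' j l hi hj := by
    rcases lt_or_ge j i' with h | h
    · simp [cell_of_lt p h]
    rcases lt_or_ge i.val p with hp | hp
    · simp [cell_of_val_lt hp, ((hi.trans_le h).trans hj).ne]
    rw [cell_of_le hp ((hi.le.trans h).trans hj.le), cell_of_le (hp.trans hi.le) h]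
    exact commute_segOp_of_nested hq p hi h hj
  diag i i' j l hi hj := by
    rcases lt_or_ge j i with h | h
    · simp [cell_of_lt p h, cell_of_lt p (h.trans hi)]
    rcases lt_or_ge i.val p with hp | hp
    · rcases eq_or_ne i j with rfl | hij
      · simp [cell_of_val_lt hp, cell_of_lt p hi]
      · simp [cell_of_val_lt hp, hij, (h.trans_lt hj).ne]
    rcases lt_or_ge l i' with h' | h'
    · simp [cell_of_lt p h', cell_of_lt p (hj.trans h')]
    rw [cell_of_le hp h, cell_of_le (hp.trans hi.le) h']
    rcases lt_or_ge j i' with h'' | h''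
    · rw [cell_of_lt p h'', mul_zero, smul_zero, sub_eq_zero]
      exact commute_segOp_of_disjoint hq p h h'' h'
    · rw [cell_of_le hp (h.trans hj.le), cell_of_le (hp.trans hi.le) h'']
      exact segOp_mul_segOp_diag hq p hi h'' hj

theorem commute_cell (hq : q ≠ 0) {p p' : ℕ} (hp : p ≠ p') (j l j' l' : Fin n) :
    Commute (cell β q p j l) (cell β q p' j' l') := by
  simp only [cell, Matrix.one_apply]
  split_ifs <;> simp [commute_segOp_of_ne hq hp]

variable (β q) in
/-- The product of the matrices `cell` for `p - 1, …, 0`. Its entries are sums over lattice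
paths. -/
noncomputable def pathOp : ℕ → Matrix (Fin n) (Fin n) (Module.End k M)
  | 0 => 1
  | p + 1 => cell β q p * pathOp p

theorem commute_cell_pathOp (hq : q ≠ 0) {p p' : ℕ} (hp : p ≤ p') (j l a b : Fin n) :
    Commute (cell β q p' j l) (pathOp β q p a b) := by
  induction p generalizing a b with
  | zero =>
    rw [pathOp, Matrix.one_apply]
    split_ifs <;> simp
  | succ p ih =>
    rw [pathOp, Matrix.mul_apply]
    exact Commute.sum_right _ _ _ fun c _ =>
      (commute_cell hq (by omega) _ _ _ _).mul_right (ih (by omega) _ _)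

theorem isQuantumMatrix_pathOp (hq : q ≠ 0) (p : ℕ) :
    IsQuantumMatrix q (pathOp β q p : Matrix (Fin n) (Fin n) (Module.End k M)) := by
  induction p with
  | zero => exact IsQuantumMatrix.one
  | succ p ih =>
    exact (isQuantumMatrix_cell hq p).mul hq ih fun _ _ _ _ => commute_cell_pathOp hq le_rfl _ _ _ _

theorem pathOp_of_lt (p : ℕ) {i j : Fin n} (h : j < i) : pathOp β q p i j = 0 := by
  induction p generalizing i j with
  | zero => exact Matrix.one_apply_ne h.ne'
  | succ p ih =>
    rw [pathOp, Matrix.mul_apply]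
    refine sum_eq_zero fun l _ => ?_
    rcases lt_or_ge j l with hl | hl
    · rw [ih hl, mul_zero]
    · rw [cell_of_lt p (hl.trans_lt h), zero_mul]

theorem pathOp_succ_apply (p : ℕ) (i j : Fin n) :
    pathOp β q (p + 1) i j = ∑ l ∈ Icc i j, cell β q p i l * pathOp β q p l j := by
  rw [pathOp, Matrix.mul_apply]
  refine (sum_subset (subset_univ _) fun l _ hl => ?_).symm
  rw [mem_Icc, not_and_or, not_le, not_le] at hl
  rcases hl with hl | hl
  · rw [cell_of_lt p hl, zero_mul]
  · rw [pathOp_of_lt p hl, mul_zero]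

theorem pathOp_succ_of_val_lt {p : ℕ} {i : Fin n} (hi : i.val < p) (j : Fin n) :
    pathOp β q (p + 1) i j = pathOp β q p i j := by
  simp [pathOp, Matrix.mul_apply, cell_of_val_lt hi, Matrix.one_apply]

theorem cell_mem_raisesLE (hq : q ≠ 0) (p : ℕ) {i l : Fin n} (hil : i ≤ l) :
    cell β q p i l ∈ raisesLE β expoWeight (p * ((l : ℤ) - i)) := by
  rcases lt_or_ge i.val p with hp | hp
  · rw [cell_of_val_lt hp, Matrix.one_apply]
    split_ifs with h
    · simpa [h] using (isLead_one (β := β) (w := expoWeight)).mem_raisesLE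
    · exact zero_mem _
  · rw [cell_of_le hp hil, ← expoWeight_seg hil]
    exact (isLead_segOp hq _ _ _ _).mem_raisesLE

theorem pathOp_mem_raisesLE (hq : q ≠ 0) (p : ℕ) {i j : Fin n} (hij : i ≤ j) :
    pathOp β q p i j ∈ raisesLE β expoWeight ((p - 1) * ((j : ℤ) - i)) := by
  induction p generalizing i with
  | zero =>
    rw [pathOp, Matrix.one_apply]
    split_ifs with h
    · simpa [h] using (isLead_one (β := β) (w := expoWeight)).mem_raisesLE
    · exact zero_mem _
  | succ p ih =>
    rw [pathOp_succ_apply]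
    refine sum_mem fun l hl => ?_
    obtain ⟨hil, hlj⟩ := mem_Icc.1 hl
    refine raisesLE_mono ?_ (mul_mem_raisesLE (cell_mem_raisesLE hq p hil) (ih hlj))
    have hlj' : (l : ℤ) ≤ j := by exact_mod_cast hlj
    push_cast
    linarith

theorem isLead_cell_self (hq : q ≠ 0) (w : Expo →+ ℤ) (p : ℕ) (i : Fin n) :
    IsLead β w 0 (cell β q p i i) := by
  rcases lt_or_ge i.val p with hp | hp
  · rw [cell_of_val_lt hp, Matrix.one_apply_eq]
    exact isLead_one
  · rw [cell_of_le hp le_rfl, ← seg_self p i]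
    exact isLead_segOp hq w p i i

theorem isLead_pathOp_self (hq : q ≠ 0) (w : Expo →+ ℤ) (p : ℕ) (i : Fin n) :
    IsLead β w 0 (pathOp β q p i i) := by
  induction p with
  | zero =>
    rw [pathOp, Matrix.one_apply_eq]
    exact isLead_one
  | succ p ih =>
    rw [pathOp_succ_apply, Icc_self, sum_singleton, ← add_zero 0]
    exact (isLead_cell_self hq w p i).mul ih

/-- The path that takes all its steps in row `i` dominates. -/
theorem isLead_pathOp_succ (hq : q ≠ 0) {i j : Fin n} (hij : i ≤ j) :
    IsLead β expoWeight (seg i i j) (pathOp β q (i + 1) i j) := by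
  have hterm : IsLead β expoWeight (seg i i j) (cell β q i i j * pathOp β q i j j) := by
    rw [cell_of_le le_rfl hij, ← add_zero (seg i i j)]
    exact (isLead_segOp hq _ _ _ _).mul (isLead_pathOp_self hq _ _ _)
  rw [pathOp_succ_apply, ← add_sum_erase _ _ (right_mem_Icc.2 hij)]
  refine hterm.add (sum_mem fun l hl => ?_)
  rw [Icc_erase_right, mem_Ico] at hl
  rw [expoWeight_seg hij]
  refine raisesLE_mono ?_ (mul_mem_raisesLE (cell_mem_raisesLE hq i hl.1)
    (pathOp_mem_raisesLE hq i hl.2.le))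
  have hlj : (l : ℤ) + 1 ≤ j := by exact_mod_cast hl.2
  linarith

theorem isLead_pathOp (hq : q ≠ 0) {p : ℕ} {i j : Fin n} (hi : i.val < p) (hij : i ≤ j) :
    IsLead β expoWeight (seg i i j) (pathOp β q p i j) := by
  induction p, Nat.succ_le_of_lt hi using Nat.le_induction with
  | base => exact isLead_pathOp_succ hq hij
  | succ p hp ih =>
    rw [pathOp_succ_of_val_lt hp]
    exact ih hp

variable (β) in
theorem exists_algHom_isLead (hq : q ≠ 0) {m : ℕ} (hmn : m ≤ n) :
    ∃ φ : QMatrix q m n →ₐ[k] Module.End k M, ∀ (i : Fin m) (j : Fin n),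
      (i.val ≤ j → IsLead β expoWeight (seg i i j) (φ (X q i j))) ∧
      (j.val < i → φ (X q i j) = 0) := by
  have hpath := (isQuantumMatrix_pathOp (β := β) (n := n) hq m).submatrix
    (Fin.strictMono_castLE hmn) strictMono_id
  obtain ⟨φ, hφ⟩ := hpath.exists_algHom
  refine ⟨φ, fun i j => ?_⟩
  rw [hφ, Matrix.submatrix_apply, id]
  exact ⟨fun hij => isLead_pathOp (i := Fin.castLE hmn i) hq i.isLt hij,
    fun hji => pathOp_of_lt m (Fin.lt_def.2 hji)⟩

end PathModel

section Rearrangement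

theorem perm_eq_one_of_monotone {m : ℕ} {σ : Equiv.Perm (Fin m)} (hσ : Monotone σ) : σ = 1 :=
  DFunLike.coe_injective <| ((hσ.strictMono_of_injective σ.injective).range_inj
    strictMono_id).1 (by rw [σ.surjective.range_eq, Set.range_id])

theorem sum_mul_comp_perm_lt {m : ℕ} {f g : Fin m → ℤ} (hf : StrictMono f) (hg : StrictMono g)
    {σ : Equiv.Perm (Fin m)} (hσ : σ ≠ 1) : ∑ a, f a * g (σ a) < ∑ a, f a * g a := by
  have hfg : Monovary f g := fun a b hab => hf.monotone (hg.lt_iff_lt.1 hab).le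
  refine hfg.sum_mul_comp_perm_lt_sum_mul_iff.2 fun h => hσ (perm_eq_one_of_monotone ?_)
  intro a b hab
  by_contra! hlt
  exact hlt.ne (congrArg σ (hab.antisymm (hf.le_iff_le.1 (h (hg hlt)))).symm)

theorem val_le_val_orderEmb {m n : ℕ} (J : Fin m ↪o Fin n) (a : Fin m) : a.val ≤ J a := by
  calc a.val = #((Iio a).map J.toEmbedding) := by rw [card_map, Fin.card_Iio]
    _ ≤ #(Iio (J a)) := card_le_card fun b hb => by
        obtain ⟨c, hc, rfl⟩ := mem_map.1 hb
        exact mem_Iio.2 (J.strictMono (mem_Iio.1 hc))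
    _ = J a := Fin.card_Iio _

end Rearrangement

section CountP

theorem count_add_countP_succ_le (l : List ℕ) (a : ℕ) :
    l.count a + l.countP (a + 1 ≤ ·) = l.countP (a ≤ ·) := by
  induction l with
  | nil => rfl
  | cons b l ih =>
    simp only [List.count_cons, List.countP_cons, ← ih, beq_iff_eq, decide_eq_true_eq]
    split_ifs <;> omega

theorem eq_of_countP_le_eq {l l' : List ℕ} (hl : l.SortedLE) (hl' : l'.SortedLE)
    (h : ∀ b, l.countP (b ≤ ·) = l'.countP (b ≤ ·)) : l = l' := by
  refine List.Perm.eq_of_sortedLE hl hl' (List.perm_iff_count.2 fun a => ?_)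
  have hcount := count_add_countP_succ_le l a
  rw [h a, h (a + 1), ← count_add_countP_succ_le l' a] at hcount
  exact Nat.add_right_cancel hcount

end CountP

section LeadingExponentOfTableau

variable {m n : ℕ}

/-- The leading exponent of the maximal minor `[J]` in the path model. -/
noncomputable def rowExpo (J : Fin m ↪o Fin n) : Expo := ∑ a : Fin m, seg a a (J a)

/-- The leading exponent of the product `[T]` in the path model. -/
noncomputable def tableauExpo (T : Tableau m n) : Expo := (T.map rowExpo).sum

theorem expoWeight_rowExpo (J : Fin m ↪o Fin n) :
    expoWeight (rowExpo J) = ∑ a : Fin m, (a : ℤ) * ((J a : ℤ) - a) := by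
  rw [rowExpo, map_sum]
  exact sum_congr rfl fun a _ => expoWeight_seg (val_le_val_orderEmb J a)

theorem rowExpo_apply (J : Fin m ↪o Fin n) (i : Fin m) {b : ℕ} (hb : i.val < b) :
    rowExpo J (i.val, b) = if b ≤ J i then 1 else 0 := by
  rw [rowExpo, Finsupp.finsetSum_apply, sum_eq_single_of_mem i (mem_univ i)]
  · simp [seg_apply, hb]
  · intro a _ ha
    simp [seg_apply, Fin.val_ne_of_ne ha]

theorem tableauExpo_apply (T : Tableau m n) (i : Fin m) {b : ℕ} (hb : i.val < b) :
    tableauExpo T (i.val, b) = (T.map fun J => (J i).val).countP (b ≤ ·) := by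
  induction T with
  | nil => rfl
  | cons J T ih =>
    rw [tableauExpo, List.map_cons, List.sum_cons, Finsupp.add_apply, rowExpo_apply J i hb,
      ← tableauExpo, ih, List.map_cons, List.countP_cons, add_comm]
    simp only [decide_eq_true_eq]

theorem Tableau.Preferred.sortedLE_column {T : Tableau m n} (hT : T.Preferred) (i : Fin m) :
    (T.map fun J => (J i).val).SortedLE := by
  have : IsTrans (Fin m ↪o Fin n) StarLE := ⟨fun A B C h h' a => (h a).trans (h' a)⟩
  refine List.Pairwise.sortedLE (List.pairwise_map.2 ?_)
  exact (List.isChain_iff_pairwise.1 hT).imp fun h => h i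

/-- The exponent of the variable `(i, b)` counts the entries `≥ b` of column `i`, and a sorted
column is determined by these numbers. -/
theorem Tableau.Preferred.eq_of_tableauExpo_eq {T T' : Tableau m n} (hT : T.Preferred)
    (hT' : T'.Preferred) (hlen : T.length = T'.length) (h : tableauExpo T = tableauExpo T') :
    T = T' := by
  have countP_of_le (i : Fin m) {b : ℕ} (hb : b ≤ i) (S : Tableau m n) :
      (S.map fun J => (J i).val).countP (b ≤ ·) = S.length := by
    rw [List.countP_map, List.countP_eq_length]
    exact fun J _ => decide_eq_true (hb.trans (val_le_val_orderEmb J i))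
  have hcolumn (i : Fin m) : (T.map fun J => (J i).val) = T'.map fun J => (J i).val := by
    refine eq_of_countP_le_eq (hT.sortedLE_column i) (hT'.sortedLE_column i) fun b => ?_
    rcases lt_or_ge i.val b with hb | hb
    · rw [← tableauExpo_apply T i hb, ← tableauExpo_apply T' i hb, h]
    · rw [countP_of_le i hb, countP_of_le i hb, hlen]
  refine List.ext_getElem hlen fun r hr hr' => DFunLike.ext _ _ fun i => Fin.ext ?_
  simpa [hr, hr'] using congrArg (fun l => l[r]?) (hcolumn i)

variable {k M : Type*} [Field k] [AddCommGroup M] [Module k M] {β : Module.Basis Expo k M} {q : k}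
  {φ : QMatrix q m n →ₐ[k] Module.End k M}

theorem invCount_one (s : ℕ) : invCount (1 : Equiv.Perm (Fin s)) = 0 := by
  rw [invCount, card_eq_zero, filter_eq_empty_iff]
  exact fun p _ h => h.1.asymm h.2

/-- By the rearrangement inequality the identity permutation contributes the largest weight. -/
theorem isLead_maxMinor
    (hφ : ∀ (i : Fin m) (j : Fin n),
      (i.val ≤ j → IsLead β expoWeight (seg i i j) (φ (X q i j))) ∧
      (j.val < i → φ (X q i j) = 0)) (J : Fin m ↪o Fin n) :
    IsLead β expoWeight (rowExpo J) (φ (maxMinor q J)) := by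
  have hX (i : Fin m) (j : Fin n) :
      φ (X q i j) ∈ raisesLE β expoWeight ((i : ℤ) * ((j : ℤ) - i)) := by
    rcases le_or_gt i.val j with hij | hji
    · rw [← expoWeight_seg hij]
      exact ((hφ i j).1 hij).mem_raisesLE
    · rw [(hφ i j).2 hji]
      exact zero_mem _
  have hexpand : φ (maxMinor q J) = ∑ σ : Equiv.Perm (Fin m), (-q) ^ invCount σ •
      ((List.finRange m).map fun a => φ (X q a (J (σ a)))).prod := by
    rw [maxMinor, quantumMinor, map_sum]
    refine sum_congr rfl fun σ _ => ?_
    rw [map_smul, map_list_prod, List.ofFn_eq_map, List.map_map]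
    rfl
  rw [hexpand, ← add_sum_erase _ _ (mem_univ 1)]
  refine IsLead.add ?_ (sum_mem fun σ hσ => Submodule.smul_mem _ _ ?_)
  · rw [invCount_one, pow_zero, one_smul, rowExpo, ← List.sum_ofFn, List.ofFn_eq_map]
    exact IsLead.list_prod fun a _ => (hφ a (J a)).1 (val_le_val_orderEmb J a)
  · refine raisesLE_mono ?_ (list_prod_mem_raisesLE fun a _ => hX a (J (σ a)))
    rw [← List.ofFn_eq_map, List.sum_ofFn, expoWeight_rowExpo]
    have hlt := sum_mul_comp_perm_lt (f := fun a : Fin m => (a : ℤ))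
      (g := fun a => ((J a : ℕ) : ℤ)) (fun a b h => by simpa using h)
      (fun a b h => by simpa using h) (mem_erase.1 hσ).1
    simp only [mul_sub, sum_sub_distrib]
    omega

theorem isLead_tableauProduct
    (hφ : ∀ (i : Fin m) (j : Fin n),
      (i.val ≤ j → IsLead β expoWeight (seg i i j) (φ (X q i j))) ∧
      (j.val < i → φ (X q i j) = 0)) (T : Tableau m n) :
    IsLead β expoWeight (tableauExpo T) (φ (tableauProduct q T)) := by
  rw [coe_tableauProduct, map_list_prod, List.map_map]
  exact IsLead.list_prod fun J _ => isLead_maxMinor hφ J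

theorem linearIndependent_tableauProduct_of_length (hq : q ≠ 0) (hmn : m ≤ n) (s : ℕ) :
    LinearIndependent k fun T : {T : Tableau m n // T.Preferred ∧ T.length = s} =>
      tableauProduct q T.1 := by
  let β : Module.Basis Expo k (Expo →₀ k) := Finsupp.basisSingleOne
  obtain ⟨φ, hφ⟩ := exists_algHom_isLead β hq hmn
  let evalAtOne : grassmannian q m n →ₗ[k] (Expo →₀ k) :=
    LinearMap.applyₗ (β 0) ∘ₗ φ.toLinearMap ∘ₗ (grassmannian q m n).val.toLinearMap
  have hinj : Function.Injective fun T : {T : Tableau m n // T.Preferred ∧ T.length = s} =>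
      tableauExpo T.1 := fun T T' h =>
    Subtype.ext (T.2.1.eq_of_tableauExpo_eq T'.2.1 (T.2.2.trans T'.2.2.symm) h)
  exact LinearIndependent.of_comp evalAtOne
    (linearIndependent_of_isLead hinj fun T => isLead_tableauProduct hφ T.1)

theorem linearIndependent_tableauProduct (hq : q ≠ 0) (hm : 0 < m) (hmn : m ≤ n) :
    LinearIndependent k fun T : {T : Tableau m n // T.Preferred} => tableauProduct q T.1 := by
  refine linearIndependent_of_fiber (deg := fun T => T.1.content)
    ((iSupIndep_grassmannianComponent q m n).comp multidegree_injective)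
    (fun T => tableauProduct_mem_grassmannianComponent T.1) fun μ => ?_
  have hlen (T : {T : {T : Tableau m n // T.Preferred} // T.1.content = μ}) :
      T.1.1.length = μ.card / m := by
    rw [← congrArg Multiset.card T.2, Tableau.card_content, Nat.mul_div_cancel _ hm]
  refine (linearIndependent_tableauProduct_of_length hq hmn (μ.card / m)).comp
    (fun T : {T : {T : Tableau m n // T.Preferred} // T.1.content = μ} =>
      ⟨T.1.1, T.1.2, hlen T⟩) fun T T' h => ?_
  exact Subtype.ext (Subtype.ext (congrArg (fun S => S.1) h))

end LeadingExponentOfTableau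

end QuantumGrassmannian

open QuantumGrassmannian in
theorem mainTheorem2 {k : Type*} [Field k] (q : k) (hq : q ≠ 0)
    (m n : ℕ) (hm : 0 < m) (hmn : m ≤ n) :
    (∀ c : Fin n → ℕ,
      ∃ b : Module.Basis
          {T : QuantumGrassmannian.Tableau m n //
            T.Preferred ∧ T.content = QuantumGrassmannian.multisetOf c}
          k (QuantumGrassmannian.grassmannianComponent q m n fun j => (c j : ℤ)),
        ∀ T, (b T : QuantumGrassmannian.grassmannian q m n) =
          QuantumGrassmannian.tableauProduct q T.1) ∧
    ∃ b : Module.Basis {T : QuantumGrassmannian.Tableau m n // T.Preferred}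
        k (QuantumGrassmannian.grassmannian q m n),
      ∀ T, b T = QuantumGrassmannian.tableauProduct q T.1 := by
  have hli := linearIndependent_tableauProduct hq hm hmn
  refine ⟨fun c => ?_, Module.Basis.mk hli (span_tableauProduct hq).ge,
    fun T => Module.Basis.mk_apply _ _ T⟩
  have h := exists_basis_component (deg := fun T : {T : Tableau m n // T.Preferred} => T.1.content)
    ((iSupIndep_grassmannianComponent q m n).comp multidegree_injective)
    (fun T => tableauProduct_mem_grassmannianComponent T.1) hli (span_tableauProduct hq)
    (multisetOf c)
  rw [Function.comp_apply, multidegree_multisetOf] at h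
  obtain ⟨b, hb⟩ := h
  let e := Equiv.subtypeSubtypeEquivSubtypeInter (Tableau.Preferred (m := m) (n := n))
    fun T => T.content = multisetOf c
  exact ⟨b.reindex e, fun T => by rw [Module.Basis.reindex_apply]; exact hb (e.symm T)⟩
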